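/- Let $\mathcal H=\mathcal H^0$ be a complex Hilbert space with inner product $\langle\cdot,\cdot\rangle_0$, and let $H$ be a (densely defined, possibly unbounded) self-adjoint operator in $\mathcal H$ that is positive in the sense that $\langle Hu,u\rangle_0\ge c\|u\|_0^2$ on $D(H)$ for some $c>0$. For real $k\ge 0$ let $\mathcal H^k=D(H^{k/2})$ with norm $\|u\|_k=\|H^{k/2}u\|_0$, and let $\mathcal H^\infty=\bigcap_{k\ge0}\mathcal H^k$. Write $\mathcal L(X,Y)$ for the bounded linear maps from $X$ to $Y$ with the operator norm, $\mathcal L(X)=\mathcal L(X,X)$, and $C_b(\mathbb R,X)$ for the bounded continuous maps $\mathbb R\to X$. Let $L(t)$, $t\in\mathbb R$, be linear operators in $\mathcal H$ satisfying: * **(H0)** there are integers $m\ge 0$ and $k_0>2m$ such that $t\mapsto L(t)\in C_b(\mathbb R,\mathcal L(\mathcal H^{k+2m},\mathcal H^k))$ for all real $0\le k\le k_0$ (in particular $\mathcal H^{2m}\subset D(L(t))$); * **(H1)** for every $t$, $\langle L(t)\psi,\varphi\rangle_0=\langle\psi,L(t)\varphi\rangle_0$ for all $\psi,\varphi\in\mathcal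 H^{k_0+2m}$; * **(H2)** there is a real $k_1>2m$ such that $[L(\cdot),H]H^{-1}\in C_b(\mathbb R,\mathcal L(\mathcal H^k))$ for all real $0\le k\le 2k_1$; that is, $[L(t),H]H^{-1}=L(t)-HL(t)H^{-1}$ is defined on $\mathcal H^\infty$ and extends from there to such a family. Then for every real $k$ with $0\le k\le\min(k_0,k_1)-4m$ there is a unique family $U(t,s)\in\mathcal L(\mathcal H^k)$, $t,s\in\mathbb R$, such that $(t,s)\mapsto U(t,s)w\in\mathcal H^k$ is continuous for every $w\in\mathcal H^k$ (strong continuity) and such that (i) holds; moreover (ii)–(iv) hold: * **(i) Well-posedness:** for every $s\in\mathbb R$ and $\psi_s\in\mathcal H^{k+2m}$, the function $\psi(t)=U(t,s)\psi_s$ is the unique global solution of $i\,\partial_t\psi(t)=L(t)\psi(t)$, $\psi(s)=\psi_s$, in the class $C^0(\mathbb R,\mathcal H^{k+2m})\cap C^1(\mathbb R,\mathcal H^k)$; * **(ii) Unitarity:** $\|U(t,s)\psi_s\|_0=\|\psi_s\|_0$ for all $t,s\in\mathbb R$ and $\psi_s\in\mathcal H^k$; * **(iii) Group property:** $U(t,s)=U(t,r)U(r,s)$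 and $U(s,s)=\mathbb I$ for all $t,r,s\in\mathbb R$; * **(iv) Growth:** there is $C_k>0$ such that $\|U(t,s)\|_{\mathcal L(\mathcal H^k)}\le C_k e^{C_k|t-s|}$ for all $t,s\in\mathbb R$. In particular $U(t,s)$ extends to a unitary operator on $\mathcal H^0$, the same one for all such $k$, and the extensions have the group property (iii). Furthermore, for every $t\in\mathbb R$ and every real $k\ge 2m$, the operator $L(t)$ with domain $\mathcal H^k$ is essentially self-adjoint in $\mathcal H^0$. -/

import Mathlib

open scoped InnerProductSpace NNReal BoundedContinuousFunction LinearPMap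

noncomputable section

/-- A positive self-adjoint operator `H` (unbounded, densely defined) on the Hilbert space `E`.
Positivity is strict, `⟪x, H x⟫ ≥ c ‖x‖²` for some `c > 0`, so that `H` is boundedly invertible. -/
structure PositiveSelfAdjoint (E : Type*) [NormedAddCommGroup E] [InnerProductSpace ℂ E]
    [CompleteSpace E] where
  /-- the underlying unbounded operator -/
  op : E →ₗ.[ℂ] E
  isSelfAdjoint : IsSelfAdjoint op
  lower_bound : ∃ c : ℝ, 0 < c ∧ ∀ x : op.domain, c * ‖(x : E)‖ ^ 2 ≤ (⟪(x : E), op x⟫_ℂ).re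

namespace PositiveSelfAdjoint

variable {E : Type*} [NormedAddCommGroup E] [InnerProductSpace ℂ E] [CompleteSpace E]

theorem op_symm (H : PositiveSelfAdjoint E) (x y : H.op.domain) :
    ⟪H.op x, (y : E)⟫_ℂ = ⟪(x : E), H.op y⟫_ℂ := by
  have hd : Dense (H.op.domain : Set E) := H.isSelfAdjoint.dense_domain
  have h := LinearPMap.adjoint_isFormalAdjoint hd
  rw [LinearPMap.isSelfAdjoint_def.mp H.isSelfAdjoint] at h
  exact h x y

theorem exists_norm_le (H : PositiveSelfAdjoint E) :
    ∃ c : ℝ, 0 < c ∧ ∀ x : H.op.domain, c * ‖(x : E)‖ ≤ ‖H.op x‖ := by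
  obtain ⟨c, hc, h⟩ := H.lower_bound
  refine ⟨c, hc, fun x => ?_⟩
  have h1 := h x
  have h2 : (⟪(x : E), H.op x⟫_ℂ).re ≤ ‖(x : E)‖ * ‖H.op x‖ :=
    (Complex.re_le_norm _).trans (norm_inner_le_norm _ _)
  rcases eq_or_lt_of_le (norm_nonneg (x : E)) with h0 | h0
  · rw [← h0]; simp
  · nlinarith

theorem op_surjective (H : PositiveSelfAdjoint E) (y : E) : ∃ x : H.op.domain, H.op x = y := by
  obtain ⟨c, hc, hle⟩ := H.exists_norm_le
  have hd : Dense (H.op.domain : Set E) := H.isSelfAdjoint.dense_domain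
  have hcl : IsClosed (H.op.graph : Set (E × E)) := H.isSelfAdjoint.isClosed
  have : CompleteSpace H.op.graph := hcl.completeSpace_coe
  let S : H.op.graph →L[ℂ] E := (ContinuousLinearMap.snd ℂ E E).comp H.op.graph.subtypeL
  have hmem : ∀ p : H.op.graph, ∃ x : H.op.domain, (x : E) = (p : E × E).1 ∧
      H.op x = (p : E × E).2 := fun p => (LinearPMap.mem_graph_iff _).mp p.2
  have hanti : AntilipschitzWith (max 1 (c⁻¹).toNNReal) S := by
    refine AddMonoidHomClass.antilipschitz_of_bound S (fun p => ?_)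
    obtain ⟨x, hx1, hx2⟩ := hmem p
    have h1 : ‖p‖ = max ‖(p : E × E).1‖ ‖(p : E × E).2‖ := rfl
    have h2 : S p = (p : E × E).2 := rfl
    have h3 := hle x
    rw [hx1, hx2] at h3
    have hc' : ((c⁻¹).toNNReal : ℝ) = c⁻¹ := Real.coe_toNNReal _ (inv_nonneg.mpr hc.le)
    rw [h1, h2, NNReal.coe_max, hc', NNReal.coe_one]
    refine max_le ?_ ?_
    · calc ‖(p : E × E).1‖ = c⁻¹ * (c * ‖(p : E × E).1‖) := by field_simp
        _ ≤ c⁻¹ * ‖(p : E × E).2‖ := by gcongr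
        _ ≤ _ := by gcongr; exact le_max_right _ _
    · calc ‖(p : E × E).2‖ = 1 * ‖(p : E × E).2‖ := (one_mul _).symm
        _ ≤ _ := by gcongr; exact le_max_left _ _
  have hrc : IsClosed (Set.range S) := hanti.isClosed_range S.uniformContinuous
  let K : Submodule ℂ E := LinearMap.range S.toLinearMap
  have hK : IsClosed (K : Set E) := by
    have : (K : Set E) = Set.range S := by ext z; simp [K]
    rw [this]; exact hrc
  have hop : ∀ x : H.op.domain, H.op x ∈ K := fun x =>
    ⟨⟨((x : E), H.op x), LinearPMap.mem_graph _ x⟩, rfl⟩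
  have hKtop : K = ⊤ := by
    have : CompleteSpace K := hK.completeSpace_coe
    rw [← Submodule.orthogonal_eq_bot_iff, Submodule.eq_bot_iff]
    intro z hz
    have hz' : ∀ x : H.op.domain, ⟪(0 : E), (x : E)⟫_ℂ = ⟪z, H.op x⟫_ℂ := fun x => by
      rw [inner_zero_left, Submodule.inner_left_of_mem_orthogonal (hop x) hz]
    have hzd : z ∈ H.op†.domain := LinearPMap.mem_adjoint_domain_of_exists z ⟨0, hz'⟩
    have hz0 : H.op† ⟨z, hzd⟩ = 0 := LinearPMap.adjoint_apply_eq hd ⟨z, hzd⟩ hz'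
    have hsa := LinearPMap.isSelfAdjoint_def.mp H.isSelfAdjoint
    have hgr : (z, (0 : E)) ∈ H.op.graph := by
      rw [← hsa]
      exact (LinearPMap.mem_graph_iff _).mpr ⟨⟨z, hzd⟩, rfl, hz0⟩
    obtain ⟨x, hx1, hx2⟩ := (LinearPMap.mem_graph_iff _).mp hgr
    have h3 := hle x
    rw [hx2] at h3
    simp only [norm_zero] at h3
    have : ‖(x : E)‖ = 0 := le_antisymm (by nlinarith) (norm_nonneg _)
    rw [← show (x : E) = z from hx1]
    exact norm_eq_zero.mp this
  have hy : y ∈ K := hKtop ▸ Submodule.mem_top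
  obtain ⟨p, hp⟩ := hy
  obtain ⟨x, -, hx2⟩ := hmem p
  exact ⟨x, hx2.trans hp⟩

theorem op_injective (H : PositiveSelfAdjoint E) : Function.Injective H.op := by
  obtain ⟨c, hc, hle⟩ := H.exists_norm_le
  intro x y hxy
  have h := hle (x - y)
  rw [LinearPMap.map_sub, hxy, sub_self, norm_zero] at h
  have h0 : ‖((x - y : H.op.domain) : E)‖ = 0 := le_antisymm (by nlinarith) (norm_nonneg _)
  exact sub_eq_zero.mp (Subtype.ext (norm_eq_zero.mp h0))

/-- `H` as a linear bijection of its domain onto `E`. -/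
def equiv (H : PositiveSelfAdjoint E) : H.op.domain ≃ₗ[ℂ] E :=
  LinearEquiv.ofBijective H.op.toFun ⟨H.op_injective, H.op_surjective⟩

/-- The bounded inverse `H⁻¹ : E → E`. -/
def inv (H : PositiveSelfAdjoint E) : E →L[ℂ] E :=
  LinearMap.mkContinuousOfExistsBound (H.op.domain.subtype ∘ₗ H.equiv.symm.toLinearMap) <| by
    obtain ⟨c, hc, hle⟩ := H.exists_norm_le
    refine ⟨c⁻¹, fun y => ?_⟩
    have h := hle (H.equiv.symm y)
    have h2 : H.op (H.equiv.symm y) = y := H.equiv.apply_symm_apply y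
    rw [h2] at h
    change ‖(H.equiv.symm y : E)‖ ≤ _
    rw [inv_mul_eq_div, le_div_iff₀ hc, mul_comm]
    exact h

theorem inv_mem (H : PositiveSelfAdjoint E) (y : E) : H.inv y ∈ H.op.domain :=
  (H.equiv.symm y).2

theorem op_inv (H : PositiveSelfAdjoint E) (y : E) : H.op ⟨H.inv y, H.inv_mem y⟩ = y :=
  H.equiv.apply_symm_apply y

theorem inv_op (H : PositiveSelfAdjoint E) (x : H.op.domain) : H.inv (H.op x) = x :=
  congrArg Subtype.val (H.equiv.symm_apply_apply x)

theorem inv_injective (H : PositiveSelfAdjoint E) : Function.Injective H.inv := by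
  intro x y h
  rw [← H.op_inv x, ← H.op_inv y]
  congr 1
  exact Subtype.ext h

theorem inv_nonneg (H : PositiveSelfAdjoint E) : 0 ≤ H.inv := by
  rw [ContinuousLinearMap.nonneg_iff_isPositive, ContinuousLinearMap.isPositive_def']
  refine ⟨?_, fun x => ?_⟩
  · rw [ContinuousLinearMap.isSelfAdjoint_iff_isSymmetric]
    intro x y
    have h := H.op_symm ⟨H.inv x, H.inv_mem x⟩ ⟨H.inv y, H.inv_mem y⟩
    rw [H.op_inv, H.op_inv] at h
    exact h.symm
  · obtain ⟨c, hc, hle⟩ := H.lower_bound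
    have h := hle ⟨H.inv x, H.inv_mem x⟩
    rw [H.op_inv] at h
    rw [ContinuousLinearMap.reApplyInnerSelf_apply]
    exact le_trans (by positivity) h

/-- The bounded operator `H^{-r}`, `r ≥ 0`: the power `r` of `H⁻¹`, by functional calculus. -/
def negPow (H : PositiveSelfAdjoint E) (r : ℝ≥0) : E →L[ℂ] E := H.inv ^ (r : ℝ)

theorem negPow_injective (H : PositiveSelfAdjoint E) (r : ℝ≥0) :
    Function.Injective (H.negPow r) := by
  obtain ⟨n, hn⟩ := exists_nat_ge r
  have h1 : H.inv ^ n = H.inv ^ ((n : ℝ) - (r : ℝ)) * H.negPow r := by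
    have hnr : (0 : ℝ) ≤ (n : ℝ) - r := sub_nonneg.mpr (by exact_mod_cast hn)
    rw [negPow, ← CFC.rpow_natCast H.inv n H.inv_nonneg, CFC.rpow_def, CFC.rpow_def,
      CFC.rpow_def, ← cfc_mul (fun x : ℝ≥0 => x ^ ((n : ℝ) - (r : ℝ))) (fun x : ℝ≥0 => x ^ (r : ℝ))
        H.inv (NNReal.continuous_rpow_const hnr).continuousOn
        (NNReal.continuous_rpow_const r.coe_nonneg).continuousOn]
    refine cfc_congr fun x _ => ?_
    have h := NNReal.rpow_add_of_nonneg x hnr r.coe_nonneg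
    rwa [sub_add_cancel] at h
  have h2 : Function.Injective (H.inv ^ n) := by
    have h3 : ⇑(H.inv ^ n) = H.inv^[n] := by
      rw [← ContinuousLinearMap.coe_coe, ContinuousLinearMap.toLinearMap_pow, Module.End.coe_pow]
      rfl
    rw [h3]
    exact H.inv_injective.iterate n
  rw [h1] at h2
  exact Function.Injective.of_comp h2

/-- The space `H^k = D(H^{k/2})`, `k ≥ 0`, as a subspace of `E`: the range of `H^{-k/2}`. -/
def domainPow (H : PositiveSelfAdjoint E) (k : ℝ≥0) : Submodule ℂ E :=
  LinearMap.range (H.negPow (k / 2)).toLinearMap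

/-- The space `H^k = D(H^{k/2})`, `k ≥ 0`, as a normed space in its own right;
its norm is `‖u‖_k = ‖H^{k/2} u‖`, not the norm of `E`. -/
def Scale (H : PositiveSelfAdjoint E) (k : ℝ≥0) : Type _ := H.domainPow k

namespace Scale

variable {H : PositiveSelfAdjoint E} {k : ℝ≥0}

instance : AddCommGroup (H.Scale k) := inferInstanceAs (AddCommGroup (H.domainPow k))

instance : Module ℂ (H.Scale k) := inferInstanceAs (Module ℂ (H.domainPow k))

instance : CoeOut (H.Scale k) E := ⟨fun u => Subtype.val (p := (· ∈ H.domainPow k)) u⟩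

variable (H k) in
/-- The bijection `H^{k/2} : H^k → E`, inverse to `H^{-k/2}`. -/
def halfPow : H.Scale k ≃ₗ[ℂ] E :=
  (LinearEquiv.ofInjective (H.negPow (k / 2)).toLinearMap (H.negPow_injective (k / 2))).symm

instance : NormedAddCommGroup (H.Scale k) :=
  NormedAddCommGroup.induced (H.Scale k) E (halfPow H k) (halfPow H k).injective

instance : NormedSpace ℂ (H.Scale k) :=
  NormedSpace.induced ℂ (H.Scale k) E (halfPow H k)

theorem norm_def (u : H.Scale k) : ‖u‖ = ‖halfPow H k u‖ := rfl

theorem negPow_halfPow (u : H.Scale k) : H.negPow (k / 2) (halfPow H k u) = (u : E) :=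
  congrArg Subtype.val ((LinearEquiv.ofInjective (H.negPow (k / 2)).toLinearMap
    (H.negPow_injective (k / 2))).apply_symm_apply u)

end Scale

/-- The bounded operator `B : H^a → H^b` is the restriction of the unbounded operator `T`. -/
def IsRestriction (H : PositiveSelfAdjoint E) (T : E →ₗ.[ℂ] E) {a b : ℝ≥0}
    (B : H.Scale a →L[ℂ] H.Scale b) : Prop :=
  ∀ u : H.Scale a, ∃ h : (u : E) ∈ T.domain, T ⟨u, h⟩ = (B u : E)

/-- `[T, H] H⁻¹ χ` is defined and equal to `w`: with `ψ = H⁻¹ χ`, the vectors `Hψ = χ` and `ψ` lie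
in the domain of `T`, the vector `T ψ` lies in the domain of `H`, and `T H ψ - H T ψ = w`. -/
def CommutatorInvEq (H : PositiveSelfAdjoint E) (T : E →ₗ.[ℂ] E) (χ w : E) : Prop :=
  ∃ (h₁ : χ ∈ T.domain) (h₂ : H.inv χ ∈ T.domain) (h₃ : T ⟨H.inv χ, h₂⟩ ∈ H.op.domain),
    T ⟨χ, h₁⟩ - H.op ⟨T ⟨H.inv χ, h₂⟩, h₃⟩ = w

/-- `t ↦ L(t)` belongs to `C_b(ℝ, 𝓛(H^{k+2m}, H^k))` for `0 ≤ k ≤ k₀`. -/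
def BoundedContinuousFamily (H : PositiveSelfAdjoint E) (L : ℝ → E →ₗ.[ℂ] E) (m k₀ : ℕ) : Prop :=
  ∀ k : ℝ≥0, k ≤ k₀ → ∃ F : ℝ →ᵇ (H.Scale (k + 2 * m) →L[ℂ] H.Scale k),
    ∀ t, H.IsRestriction (L t) (F t)

/-- The operator `T` is symmetric on the subspace `H^k`. -/
def SymmetricOn (H : PositiveSelfAdjoint E) (T : E →ₗ.[ℂ] E) (k : ℝ≥0) : Prop :=
  ∀ ψ φ : T.domain, (ψ : E) ∈ H.domainPow k → (φ : E) ∈ H.domainPow k →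
    ⟪T ψ, (φ : E)⟫_ℂ = ⟪(ψ : E), T φ⟫_ℂ

/-- `t ↦ [L(t), H] H⁻¹` belongs to `C_b(ℝ, 𝓛(H^k))` for `0 ≤ k ≤ 2 k₁`, where `[L(t), H] H⁻¹` is
evaluated on the dense subspace `H^∞ = ⋂ H^j`. -/
def BoundedContinuousCommutator (H : PositiveSelfAdjoint E) (L : ℝ → E →ₗ.[ℂ] E) (k₁ : ℝ≥0) :
    Prop :=
  ∀ k : ℝ≥0, k ≤ 2 * k₁ → ∃ F : ℝ →ᵇ (H.Scale k →L[ℂ] H.Scale k),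
    ∀ t, ∀ χ : H.Scale k, (∀ j : ℝ≥0, (χ : E) ∈ H.domainPow j) →
      H.CommutatorInvEq (L t) χ (F t χ : E)

/-- `ψ` is a global solution of `i ψ' = L(t) ψ`, `ψ(s) = ψₛ`, in the class
`C⁰(ℝ, H^{k+2m}) ∩ C¹(ℝ, H^k)`; the derivative is taken in `H^k`. -/
structure IsSolution (H : PositiveSelfAdjoint E) (L : ℝ → E →ₗ.[ℂ] E) (m : ℕ) (k : ℝ≥0) (s : ℝ)
    (ψs : E) (ψ : ℝ → E) : Prop where
  initial : ψ s = ψs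
  continuous : ∃ v : ℝ → H.Scale (k + 2 * m), Continuous v ∧ ∀ t, (v t : E) = ψ t
  equation : ∃ u : ℝ → H.Scale k, ContDiff ℝ 1 u ∧ (∀ t, (u t : E) = ψ t) ∧
    ∀ t, ∃ h : ψ t ∈ (L t).domain, Complex.I • ((deriv u t : H.Scale k) : E) = L t ⟨ψ t, h⟩

/-- `U` is a propagator on `H^k` of the equation `i ψ' = L(t) ψ`: the bounded operators
`U(t,s)` on `H^k` depend (strongly) continuously on `(t,s)`, and for every initial datum
`w ∈ H^{k+2m}` at time `s`, `t ↦ U(t,s) w` is the unique global solution. -/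
structure IsPropagator (H : PositiveSelfAdjoint E) (L : ℝ → E →ₗ.[ℂ] E) (m : ℕ) (k : ℝ≥0)
    (U : ℝ → ℝ → H.Scale k →L[ℂ] H.Scale k) : Prop where
  strongly_continuous : ∀ w : H.Scale k, Continuous fun p : ℝ × ℝ => U p.1 p.2 w
  isSolution : ∀ (s : ℝ) (w : H.Scale k), (w : E) ∈ H.domainPow (k + 2 * m) →
    H.IsSolution L m k s w fun t => (U t s w : E)
  unique_solution : ∀ (s : ℝ) (w : H.Scale k), (w : E) ∈ H.domainPow (k + 2 * m) →
    ∀ ψ : ℝ → E, H.IsSolution L m k s w ψ → ψ = fun t => (U t s w : E)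

end PositiveSelfAdjoint

/-- A densely defined symmetric operator is essentially self-adjoint if its closure is self-adjoint
(the closure is then its unique self-adjoint extension). -/
structure IsEssentiallySelfAdjoint {E : Type*} [NormedAddCommGroup E] [InnerProductSpace ℂ E]
    [CompleteSpace E] (T : E →ₗ.[ℂ] E) : Prop where
  dense_domain : Dense (T.domain : Set E)
  symmetric : T.IsFormalAdjoint T
  closable : T.IsClosable
  closure_isSelfAdjoint : IsSelfAdjoint T.closure

end

noncomputable section

open Filter Topology

namespace PositiveSelfAdjoint

variable {E : Type*} [NormedAddCommGroup E] [InnerProductSpace ℂ E] [CompleteSpace E]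

/-! Write A = H⁻¹. Everything is expressed by bounded operators on `E`: ℓ(t) = L(t)A^m, for which
A^m ℓ(t) is self-adjoint by (H1), and B_l(t) = A^{-l} [L(t),H]H⁻¹ A^l, bounded by (H2) for integers
l ≤ k₁ (`exists_commutatorFamily`). Moving the factors of A^j through L one at a time gives A^j ℓ −
ℓ A^j = −(∑_{l<j} B_l*) A^{j+m} (`inv_pow_commutator`): commuting L with A^j costs a bounded
operator and no derivatives.

L is replaced by the bounded self-adjoint operator J L J, with J a cutoff function of A. The Dyson
series solves that equation by unitary operators, and the commutator identity yields an energy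
estimate for ‖A^j ψ‖ whose constant does not depend on the cutoff (`abs_im_inner_mollify_le`). These
are bounds in negative norms; since the adjoint of U(t,s) is U(s,t), duality turns them into bounds
on the spaces H^{2j} (`exists_star_mul_eq_mul`). On the range of A^{m+1} the operator J L J is
within O(ε) of L (`norm_mollify_sub_le`), so by Duhamel the approximate evolutions are Cauchy there.
Unitarity and density give a strong limit that keeps the bounds and solves the equation weakly
(`exists_unitaryEvolution`).

The Löwner–Heinz inequality interpolates the bounds to real exponents, and an interpolation
inequality for the norms gives strong continuity strictly below the top exponent
(`exists_conj_negPow`). For data in H^{k+2m} the orbit is then continuous in H^{k+2m}, and the weak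
equation becomes a strong one in H^k (`hasDerivAt_of_weak_equation`). Uniqueness is conservation of
the norm of `E`.

Essential self-adjointness does not use the evolution. If v is orthogonal to the range of L + ic,
testing with A^{2m} v and taking imaginary parts bounds |c| ‖A^m v‖² by a commutator constant times
‖A^m v‖². Hence v = 0 for large |c| of either sign. -/

/-! ### Powers of H⁻¹ -/

theorem negPow_add (H : PositiveSelfAdjoint E) (a b : ℝ≥0) :
    H.negPow (a + b) = H.negPow a * H.negPow b := by
  rw [negPow, negPow, negPow, CFC.rpow_def, CFC.rpow_def, CFC.rpow_def,
    ← cfc_mul (fun x : ℝ≥0 => x ^ (a : ℝ)) (fun x : ℝ≥0 => x ^ (b : ℝ))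
      H.inv (NNReal.continuous_rpow_const a.coe_nonneg).continuousOn
      (NNReal.continuous_rpow_const b.coe_nonneg).continuousOn]
  refine cfc_congr fun x _ => ?_
  rw [NNReal.coe_add]
  exact NNReal.rpow_add_of_nonneg x a.coe_nonneg b.coe_nonneg

theorem negPow_natCast (H : PositiveSelfAdjoint E) (n : ℕ) : H.negPow n = H.inv ^ n := by
  rw [negPow, NNReal.coe_natCast, CFC.rpow_natCast _ _ H.inv_nonneg]

theorem negPow_zero (H : PositiveSelfAdjoint E) : H.negPow 0 = 1 := by
  simpa using H.negPow_natCast 0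

theorem negPow_nonneg (H : PositiveSelfAdjoint E) (r : ℝ≥0) : 0 ≤ H.negPow r := CFC.rpow_nonneg

theorem isSelfAdjoint_negPow (H : PositiveSelfAdjoint E) (r : ℝ≥0) :
    IsSelfAdjoint (H.negPow r) := IsSelfAdjoint.of_nonneg (H.negPow_nonneg r)

theorem isSelfAdjoint_inv (H : PositiveSelfAdjoint E) : IsSelfAdjoint H.inv :=
  IsSelfAdjoint.of_nonneg H.inv_nonneg

theorem negPow_comm (H : PositiveSelfAdjoint E) (a b : ℝ≥0) :
    H.negPow a * H.negPow b = H.negPow b * H.negPow a := by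
  rw [← negPow_add, ← negPow_add, add_comm]

end PositiveSelfAdjoint

/-- A bounded self-adjoint operator can be moved across the inner product. -/
theorem IsSelfAdjoint.inner_apply_left {E : Type*} [NormedAddCommGroup E] [InnerProductSpace ℂ E]
    [CompleteSpace E] {S : E →L[ℂ] E} (hS : IsSelfAdjoint S) (x y : E) :
    ⟪S x, y⟫_ℂ = ⟪x, S y⟫_ℂ :=
  (ContinuousLinearMap.isSelfAdjoint_iff_isSymmetric.mp hS) x y

/-- An injective bounded self-adjoint operator has dense range. -/
theorem IsSelfAdjoint.denseRange_of_injective {E : Type*} [NormedAddCommGroup E]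
    [InnerProductSpace ℂ E] [CompleteSpace E] {S : E →L[ℂ] E} (hS : IsSelfAdjoint S)
    (hinj : Function.Injective S) : DenseRange S := by
  have h : (LinearMap.range S.toLinearMap)ᗮ = ⊥ := by
    rw [Submodule.eq_bot_iff]
    intro z hz
    have h0 : S z = 0 := by
      rw [← inner_self_eq_zero (𝕜 := ℂ), hS.inner_apply_left]
      exact Submodule.inner_left_of_mem_orthogonal (LinearMap.mem_range_self _ _) hz
    exact hinj (by rw [h0, map_zero])
  rw [← Submodule.topologicalClosure_eq_top_iff] at h
  have h2 : Dense (LinearMap.range S.toLinearMap : Set E) := by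
    rwa [← Submodule.dense_iff_topologicalClosure_eq_top] at h
  have h3 : (LinearMap.range S.toLinearMap : Set E) = Set.range S := by ext; simp
  rwa [h3] at h2

namespace PositiveSelfAdjoint

variable {E : Type*} [NormedAddCommGroup E] [InnerProductSpace ℂ E] [CompleteSpace E]

theorem denseRange_negPow (H : PositiveSelfAdjoint E) (r : ℝ≥0) : DenseRange (H.negPow r) :=
  (H.isSelfAdjoint_negPow r).denseRange_of_injective (H.negPow_injective r)

/-! ### Spectral cutoffs -/

/-- The cutoff function `x ↦ (x - ε)₊ / max x ε`, divided by `max x ε ^ r`. -/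
def cutoffFun (ε r x : ℝ≥0) : ℝ≥0 := (x - ε) / max x ε * (max x ε ^ (r : ℝ))⁻¹

theorem continuous_cutoffFun {ε : ℝ≥0} (hε : 0 < ε) (r : ℝ≥0) : Continuous (cutoffFun ε r) := by
  have hmax : ∀ x : ℝ≥0, max x ε ≠ 0 := fun x => (lt_of_lt_of_le hε (le_max_right _ _)).ne'
  refine Continuous.mul (Continuous.div₀ (by fun_prop) (by fun_prop) hmax) ?_
  refine Continuous.inv₀ ((NNReal.continuous_rpow_const r.coe_nonneg).comp (by fun_prop)) ?_
  intro x
  exact (NNReal.rpow_pos (pos_iff_ne_zero.mpr (hmax x))).ne'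

/-- The cutoff vanishes on [0, ε], and beyond ε the regularised power (max x ε)^r is x^r itself; so
dividing by x^r is harmless. -/
theorem rpow_mul_cutoffFun {ε : ℝ≥0} (hε : 0 < ε) (r x : ℝ≥0) :
    x ^ (r : ℝ) * cutoffFun ε r x = cutoffFun ε 0 x := by
  rcases le_total x ε with h | h
  · simp [cutoffFun, tsub_eq_zero_of_le h]
  · have hx : 0 < x := hε.trans_le h
    have hx' : x ^ (r : ℝ) ≠ 0 := (NNReal.rpow_pos hx).ne'
    simp only [cutoffFun, max_eq_left h, NNReal.coe_zero, NNReal.rpow_zero]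
    field_simp

/-- The operator `f(A) A^{-r}` for `A = H⁻¹` and the cutoff function `f(x) = (x - ε)₊ / max x ε`. -/
def cutoff (H : PositiveSelfAdjoint E) (ε r : ℝ≥0) : E →L[ℂ] E := cfc (cutoffFun ε r) H.inv

theorem negPow_mul_cutoff (H : PositiveSelfAdjoint E) {ε : ℝ≥0} (hε : 0 < ε) (r : ℝ≥0) :
    H.negPow r * H.cutoff ε r = H.cutoff ε 0 := by
  rw [negPow, CFC.rpow_def, cutoff, ← cfc_mul (fun x : ℝ≥0 => x ^ (r : ℝ)) (cutoffFun ε r)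
      H.inv (NNReal.continuous_rpow_const r.coe_nonneg).continuousOn
      (continuous_cutoffFun hε r).continuousOn]
  exact cfc_congr fun x _ => rpow_mul_cutoffFun hε r x

theorem cutoff_mul_negPow (H : PositiveSelfAdjoint E) (ε r s : ℝ≥0) :
    H.cutoff ε r * H.negPow s = H.negPow s * H.cutoff ε r := by
  rw [negPow, CFC.rpow_def]
  exact cfc_commute_cfc _ _ _

theorem isSelfAdjoint_cutoff (H : PositiveSelfAdjoint E) (ε r : ℝ≥0) :
    IsSelfAdjoint (H.cutoff ε r) := IsSelfAdjoint.of_nonneg (cfc_predicate _ _)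

theorem norm_cutoff_zero_le (H : PositiveSelfAdjoint E) (ε : ℝ≥0) :
    ‖H.cutoff ε 0‖ ≤ 1 := by
  have h : ‖H.cutoff ε 0‖₊ ≤ 1 := by
    refine nnnorm_cfc_nnreal_le fun x _ => ?_
    simp only [cutoffFun, NNReal.coe_zero, NNReal.rpow_zero, inv_one, mul_one]
    exact div_le_one_of_le₀ (tsub_le_self.trans (le_max_left _ _)) zero_le
  exact_mod_cast h

/-- With f the cutoff function, x − x f(x) = min(x, ε). This linear rate is what later makes the
approximate evolutions Cauchy. -/
theorem norm_inv_sub_cutoff_le (H : PositiveSelfAdjoint E) {ε : ℝ≥0} (hε : 0 < ε) :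
    ‖H.inv - H.inv * H.cutoff ε 0‖ ≤ ε := by
  have hc : Continuous (cutoffFun ε 0) := continuous_cutoffFun hε 0
  have hd : Continuous fun x : ℝ≥0 => x - x * cutoffFun ε 0 x := by fun_prop
  have hle : ∀ x, x * cutoffFun ε 0 x ≤ x := fun x => by
    refine mul_le_of_le_one_right zero_le ?_
    simp only [cutoffFun, NNReal.coe_zero, NNReal.rpow_zero, inv_one, mul_one]
    exact div_le_one_of_le₀ (tsub_le_self.trans (le_max_left _ _)) zero_le
  have h2 : H.inv * H.cutoff ε 0 = cfc (fun x : ℝ≥0 => x * cutoffFun ε 0 x) H.inv := by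
    conv_lhs => rw [← cfc_id' ℝ≥0 H.inv H.inv_nonneg]
    rw [cutoff, cfc_id' ℝ≥0 H.inv H.inv_nonneg]
    rw [cfc_mul (fun x : ℝ≥0 => x) (cutoffFun ε 0) H.inv continuousOn_id hc.continuousOn,
      cfc_id' ℝ≥0 H.inv H.inv_nonneg]
  have h1 : cfc (fun x : ℝ≥0 => x - x * cutoffFun ε 0 x) H.inv = H.inv - H.inv * H.cutoff ε 0 := by
    rw [eq_sub_iff_add_eq, h2, ← cfc_add _ (fun x : ℝ≥0 => x - x * cutoffFun ε 0 x)
      (fun x : ℝ≥0 => x * cutoffFun ε 0 x) hd.continuousOn (by fun_prop)]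
    conv_rhs => rw [← cfc_id' ℝ≥0 H.inv H.inv_nonneg]
    exact cfc_congr fun x _ => tsub_add_cancel_of_le (hle x)
  rw [← h1]
  have h : ‖cfc (fun x : ℝ≥0 => x - x * cutoffFun ε 0 x) H.inv‖₊ ≤ ε := by
    refine nnnorm_cfc_nnreal_le fun x _ => ?_
    rcases le_total x ε with h | h
    · exact tsub_le_self.trans h
    · have hx : x ≠ 0 := (hε.trans_le h).ne'
      simp only [cutoffFun, NNReal.coe_zero, NNReal.rpow_zero, inv_one, mul_one, max_eq_left h]
      rw [mul_div_cancel₀ _ hx, tsub_tsub_cancel_of_le h]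
  exact_mod_cast h

/-- On the range of A the convergence has rate ε; contractivity of the cutoffs and density of that
range do the rest. -/
theorem tendsto_cutoff (H : PositiveSelfAdjoint E) (x : E) :
    Tendsto (fun n : ℕ => H.cutoff (1 / (n + 1 : ℝ≥0)) 0 x) atTop (𝓝 x) := by
  rw [Metric.tendsto_atTop]
  intro δ hδ
  obtain ⟨_, ⟨y, rfl⟩, hy⟩ := Metric.mem_closure_iff.mp
    ((H.isSelfAdjoint_inv.denseRange_of_injective H.inv_injective) x) (δ / 3) (by positivity)
  rw [dist_eq_norm] at hy
  have h0 : Tendsto (fun n : ℕ => (1 / ((n : ℝ) + 1)) * ‖y‖) atTop (𝓝 0) := by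
    simpa using tendsto_one_div_add_atTop_nhds_zero_nat.mul_const ‖y‖
  obtain ⟨N, hN⟩ := (h0.eventually_lt_const (show (0 : ℝ) < δ / 3 by positivity)).exists_forall_of_atTop
  refine ⟨N, fun n hn => ?_⟩
  have hε : (0 : ℝ≥0) < 1 / (n + 1 : ℝ≥0) := by positivity
  have hcomm : H.inv * H.cutoff (1 / (n + 1 : ℝ≥0)) 0 = H.cutoff (1 / (n + 1 : ℝ≥0)) 0 * H.inv := by
    have := H.cutoff_mul_negPow (1 / (n + 1 : ℝ≥0)) 0 ((1 : ℕ) : ℝ≥0)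
    rw [negPow_natCast, pow_one] at this
    exact this.symm
  have h1 := (H.inv - H.inv * H.cutoff (1 / (n + 1 : ℝ≥0)) 0).le_of_opNorm_le
    (H.norm_inv_sub_cutoff_le hε) y
  rw [hcomm] at h1
  set J := H.cutoff (1 / (n + 1 : ℝ≥0)) 0
  have h2 : J x - x = J (x - H.inv y) - (x - H.inv y) - (H.inv - J * H.inv) y := by
    simp only [map_sub, sub_apply, mul_apply_eq_comp]
    abel
  have h3 : ‖J (x - H.inv y)‖ ≤ 1 * ‖x - H.inv y‖ := J.le_of_opNorm_le (H.norm_cutoff_zero_le _) _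
  have h4 := hN n hn
  have h5 : ((1 / (n + 1 : ℝ≥0) : ℝ≥0) : ℝ) = 1 / ((n : ℝ) + 1) := by push_cast; rfl
  rw [h5] at h1
  rw [dist_eq_norm, h2]
  calc _ ≤ ‖J (x - H.inv y)‖ + ‖x - H.inv y‖ + ‖(H.inv - J * H.inv) y‖ :=
        (norm_sub_le _ _).trans (by gcongr; exact norm_sub_le _ _)
    _ < δ := by linarith

theorem cutoff_mem_domainPow (H : PositiveSelfAdjoint E) {ε : ℝ≥0} (hε : 0 < ε) (y : E) (k : ℝ≥0) :
    H.cutoff ε 0 y ∈ H.domainPow k :=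
  ⟨H.cutoff ε (k / 2) y, by
    rw [← H.negPow_mul_cutoff hε (k / 2)]; rfl⟩

/-! ### Interpolation between powers of H⁻¹ -/

theorem negPow_rpow (H : PositiveSelfAdjoint E) (a θ : ℝ≥0) :
    H.negPow a ^ (θ : ℝ) = H.negPow (a * θ) := by
  rw [negPow, CFC.rpow_rpow_of_exponent_nonneg _ _ _ a.coe_nonneg θ.coe_nonneg H.inv_nonneg, negPow,
    NNReal.coe_mul]

theorem norm_negPow_sq (H : PositiveSelfAdjoint E) (a : ℝ≥0) (x : E) :
    ‖H.negPow a x‖ ^ 2 = (⟪H.negPow (a + a) x, x⟫_ℂ).re := by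
  rw [negPow_add, mul_apply_eq_comp, (H.isSelfAdjoint_negPow a).inner_apply_left]
  exact norm_sq_eq_re_inner (𝕜 := ℂ) _

/-- If `‖A^j V x‖ ≤ C ‖A^j x‖` for a unitary operator `V`, the same holds with `A^r`, `r ≤ j`. -/
theorem norm_negPow_le_of_norm_negPow_le (H : PositiveSelfAdjoint E) {V : E →L[ℂ] E}
    (hV : V ∈ unitary (E →L[ℂ] E)) {C : ℝ} (hC : 1 ≤ C) {j r : ℝ≥0} (hrj : r ≤ j)
    (h : ∀ x, ‖H.negPow j (V x)‖ ≤ C * ‖H.negPow j x‖) (x : E) :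
    ‖H.negPow r (V x)‖ ≤ C * ‖H.negPow r x‖ := by
  rcases eq_or_ne j 0 with rfl | hj
  · obtain rfl : r = 0 := le_antisymm hrj zero_le
    exact h x
  have hinner : ∀ a : ℝ≥0, ∀ y, ⟪(star V * H.negPow a * V) y, y⟫_ℂ =
      ⟪H.negPow a (V y), V y⟫_ℂ := fun a y => by
    rw [mul_apply_eq_comp, mul_apply_eq_comp, ContinuousLinearMap.star_eq_adjoint,
      ContinuousLinearMap.adjoint_inner_left]
  have hconj : ∀ a : ℝ≥0, IsSelfAdjoint (star V * H.negPow a * V) := fun a =>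
    (H.isSelfAdjoint_negPow a).conjugate' V
  set c : ℝ≥0 := C.toNNReal ^ 2 with hc
  have hcC : (c : ℝ) = C ^ 2 := by
    rw [hc, NNReal.coe_pow, Real.coe_toNNReal _ (zero_le_one.trans hC)]
  have hsm : ∀ T : E →L[ℂ] E, c • T = ((C ^ 2 : ℝ) : ℂ) • T := fun T => by
    rw [NNReal.smul_def, hcC]; rfl
  have hre : ∀ (T : E →L[ℂ] E) (y : E), (⟪(c • T) y, y⟫_ℂ).re = C ^ 2 * (⟪T y, y⟫_ℂ).re :=
    fun T y => by
      rw [hsm, smul_apply, inner_smul_left, Complex.conj_ofReal, Complex.re_ofReal_mul]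
  -- The hypothesis squared, as an operator inequality V* A^{2j} V ≤ C² A^{2j}.
  have hle : star V * H.negPow (j + j) * V ≤ c • H.negPow (j + j) := by
    rw [ContinuousLinearMap.le_def, ContinuousLinearMap.isPositive_def']
    refine ⟨IsSelfAdjoint.sub ?_ (hconj _), fun y => ?_⟩
    · rw [hsm]
      exact IsSelfAdjoint.smul (by simp [IsSelfAdjoint]) (H.isSelfAdjoint_negPow _)
    rw [ContinuousLinearMap.reApplyInnerSelf_apply, sub_apply, inner_sub_left, hinner, map_sub,
      sub_nonneg]
    have h1 := h y
    have h2 := pow_le_pow_left₀ (norm_nonneg _) h1 2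
    rw [mul_pow, norm_negPow_sq, norm_negPow_sq] at h2
    refine h2.trans (le_of_eq ?_)
    exact (hre _ _).symm
  set θ : ℝ≥0 := r / j with hθ
  have hθ1 : θ ≤ 1 := div_le_one_of_le₀ hrj zero_le
  have hjr : (j + j) * θ = r + r := by rw [add_mul, hθ, mul_div_cancel₀ _ hj]
  -- Löwner–Heinz: x ↦ x^θ is operator monotone for 0 ≤ θ ≤ 1. Unitarity of V lets the power pass
  -- through the conjugation, and C ≥ 1 lets C^{2θ} be replaced by C².
  have hmono := CFC.rpow_le_rpow (p := (θ : ℝ)) ⟨θ.coe_nonneg, by exact_mod_cast hθ1⟩ hle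
  have hleft : (star V * H.negPow (j + j) * V) ^ (θ : ℝ) = star V * H.negPow (r + r) * V := by
    have hφ := StarAlgHomClass.map_cfc (S := ℂ)
      (Unitary.conjStarAlgAut ℂ (E →L[ℂ] E) (star ⟨V, hV⟩))
      (fun x : ℝ≥0 => x ^ (θ : ℝ)) (H.negPow (j + j))
      (NNReal.continuous_rpow_const θ.coe_nonneg).continuousOn
      (by
        have : ⇑(Unitary.conjStarAlgAut ℂ (E →L[ℂ] E) (star ⟨V, hV⟩)) =
          fun x => star V * x * V := by
            funext x; simp [Unitary.conjStarAlgAut_apply]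
        rw [this]; fun_prop) (H.negPow_nonneg _) (map_nonneg _ (H.negPow_nonneg _))
    rw [← CFC.rpow_def, ← CFC.rpow_def, negPow_rpow, hjr] at hφ
    simpa [Unitary.conjStarAlgAut_apply] using hφ.symm
  have hright : (c • H.negPow (j + j)) ^ (θ : ℝ) ≤ c • H.negPow (r + r) := by
    have hcont : Continuous fun x : ℝ≥0 => x ^ (θ : ℝ) :=
      NNReal.continuous_rpow_const θ.coe_nonneg
    have hc1 : 1 ≤ c := by
      rw [hc]; exact one_le_pow₀ (by simpa using hC)
    have hcθ : c ^ (θ : ℝ) ≤ c := by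
      conv_rhs => rw [← NNReal.rpow_one c]
      exact NNReal.rpow_le_rpow_of_exponent_le hc1 (by exact_mod_cast hθ1)
    have h4 : (c • H.negPow (j + j)) ^ (θ : ℝ) = c ^ (θ : ℝ) • H.negPow (r + r) := by
      have h5 : c • H.negPow (j + j) = cfc (fun x : ℝ≥0 => c * x) (H.negPow (j + j)) := by
        rw [cfc_const_mul c (fun x : ℝ≥0 => x) _ continuousOn_id,
          cfc_id' ℝ≥0 _ (H.negPow_nonneg _)]
      rw [h5, CFC.rpow_def, ← cfc_comp' (fun x : ℝ≥0 => x ^ (θ : ℝ)) (fun x : ℝ≥0 => c * x) _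
        hcont.continuousOn (by fun_prop) (H.negPow_nonneg _)]
      simp_rw [NNReal.mul_rpow]
      rw [cfc_const_mul _ _ _ hcont.continuousOn, ← CFC.rpow_def, negPow_rpow, hjr]
    rw [h4]
    have h6 : c • H.negPow (r + r) - c ^ (θ : ℝ) • H.negPow (r + r) =
        (c - c ^ (θ : ℝ)) • H.negPow (r + r) := by
      rw [sub_eq_iff_eq_add, ← add_smul, tsub_add_cancel_of_le hcθ]
    rw [← sub_nonneg, h6]
    exact smul_nonneg zero_le (H.negPow_nonneg _)
  rw [hleft] at hmono
  have hfin := hmono.trans hright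
  rw [ContinuousLinearMap.le_def, ContinuousLinearMap.isPositive_def'] at hfin
  have h3 := hfin.2 x
  rw [ContinuousLinearMap.reApplyInnerSelf_apply, sub_apply, inner_sub_left, hinner, map_sub,
      sub_nonneg] at h3
  refine le_of_sq_le_sq ?_ (by positivity)
  rw [mul_pow, norm_negPow_sq, norm_negPow_sq]
  exact h3.trans (le_of_eq (hre _ _))

/-- If `y` is bounded and `A^j y → 0` then `A^δ y → 0` for all `δ > 0`. -/
theorem tendsto_negPow_zero (H : PositiveSelfAdjoint E) {ι : Type*} {f : Filter ι} {y : ι → E}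
    {M : ℝ} (hM : ∀ᶠ i in f, ‖y i‖ ≤ M) {j : ℝ≥0} (h : Tendsto (fun i => H.negPow j (y i)) f (𝓝 0))
    {δ : ℝ≥0} (hδ : 0 < δ) : Tendsto (fun i => H.negPow δ (y i)) f (𝓝 0) := by
  -- ‖A^d y‖² = ⟨A^{2d} y, y⟩ ≤ M ‖A^{2d} y‖, so the exponent may be halved; finitely many halvings
  -- lead from an exponent at least j down to δ.
  have step : ∀ d : ℝ≥0, Tendsto (fun i => H.negPow (d + d) (y i)) f (𝓝 0) →
      Tendsto (fun i => H.negPow d (y i)) f (𝓝 0) := by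
    intro d hd
    rw [tendsto_zero_iff_norm_tendsto_zero] at hd ⊢
    have h1 : Tendsto (fun i => ‖H.negPow (d + d) (y i)‖ * M) f (𝓝 0) := by
      simpa using hd.mul_const M
    have h2 : Tendsto (fun i => ‖H.negPow d (y i)‖ ^ 2) f (𝓝 0) := by
      refine squeeze_zero' (Eventually.of_forall fun i => by positivity) ?_ h1
      filter_upwards [hM] with i hi
      have h3 : ⟪H.negPow d (y i), H.negPow d (y i)⟫_ℂ = ⟪H.negPow (d + d) (y i), y i⟫_ℂ := by
        rw [← (H.isSelfAdjoint_negPow d).inner_apply_left, negPow_add]; rfl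
      have h4 : ‖H.negPow d (y i)‖ ^ 2 = (⟪H.negPow (d + d) (y i), y i⟫_ℂ).re := by
        rw [← h3]; exact norm_sq_eq_re_inner (𝕜 := ℂ) _
      rw [h4]
      exact (Complex.re_le_norm _).trans ((norm_inner_le_norm _ _).trans (by gcongr))
    simpa [Real.sqrt_sq] using h2.sqrt
  have iter : ∀ n : ℕ, ∀ d : ℝ≥0, Tendsto (fun i => H.negPow (2 ^ n * d) (y i)) f (𝓝 0) →
      Tendsto (fun i => H.negPow d (y i)) f (𝓝 0) := by
    intro n
    induction n with
    | zero => intro d hd; simpa using hd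
    | succ n ih =>
      intro d hd
      refine ih d (step _ ?_)
      rwa [← two_mul, ← mul_assoc, ← pow_succ']
  obtain ⟨n, hn⟩ := pow_unbounded_of_one_lt (j / δ) (one_lt_two : (1 : ℝ≥0) < 2)
  refine iter n δ ?_
  have hle : j ≤ 2 ^ n * δ := by
    rw [div_lt_iff₀ hδ] at hn; exact hn.le
  have h5 : ∀ i, H.negPow (2 ^ n * δ) (y i) = H.negPow (2 ^ n * δ - j) (H.negPow j (y i)) := by
    intro i
    conv_lhs => rw [← tsub_add_cancel_of_le hle, negPow_add]
    rfl
  simp_rw [h5]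
  have h6 := ((H.negPow (2 ^ n * δ - j)).continuous.tendsto 0).comp h
  rwa [map_zero] at h6

end PositiveSelfAdjoint

/-! ### Linear equations with bounded coefficients -/

/-- The terms of the Dyson series of the equation `V' = M V`, `V(s) = 1`. -/
def dysonTerm {𝔸 : Type*} [NormedRing 𝔸] [NormedAlgebra ℝ 𝔸] (M : ℝ → 𝔸) (s : ℝ) : ℕ → ℝ → 𝔸
  | 0, _ => 1
  | n + 1, t => ∫ r in s..t, M r * dysonTerm M s n r

section Dyson

variable {𝔸 : Type*} [NormedRing 𝔸] [NormedAlgebra ℝ 𝔸] {M : ℝ → 𝔸} {K : ℝ}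

theorem continuous_dysonTerm (hM : Continuous M) (s : ℝ) (n : ℕ) :
    Continuous (dysonTerm M s n) := by
  induction n with
  | zero => exact continuous_const
  | succ n ih =>
    exact intervalIntegral.continuous_primitive
      (fun a b => (hM.mul ih).intervalIntegrable a b) s

theorem hasDerivAt_dysonTerm_succ [CompleteSpace 𝔸] (hM : Continuous M) (s : ℝ) (n : ℕ) (t : ℝ) :
    HasDerivAt (dysonTerm M s (n + 1)) (M t * dysonTerm M s n t) t := by
  have hc : Continuous fun r => M r * dysonTerm M s n r := hM.mul (continuous_dysonTerm hM s n)
  exact intervalIntegral.integral_hasDerivAt_right (hc.intervalIntegrable s t)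
    (hc.stronglyMeasurableAtFilter _ _) hc.continuousAt

theorem norm_dysonTerm_le [NormOneClass 𝔸] (hM : Continuous M) (hK : ∀ t, ‖M t‖ ≤ K) (s : ℝ) (n : ℕ) (t : ℝ) :
    ‖dysonTerm M s n t‖ ≤ (K * |t - s|) ^ n / n.factorial := by
  have hK0 : 0 ≤ K := (norm_nonneg _).trans (hK 0)
  induction n generalizing t with
  | zero => simp [dysonTerm]
  | succ n ih =>
    have hc : Continuous fun r => M r * dysonTerm M s n r := hM.mul (continuous_dysonTerm hM s n)
    calc ‖dysonTerm M s (n + 1) t‖ ≤ ∫ r in Set.uIoc s t, ‖M r * dysonTerm M s n r‖ :=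
          intervalIntegral.norm_integral_le_integral_norm_uIoc
      _ ≤ ∫ r in Set.uIoc s t, K ^ (n + 1) / n.factorial * |r - s| ^ n := by
          refine MeasureTheory.integral_mono ?_ ?_ fun r => ?_
          · exact (hc.norm.integrableOn_uIoc)
          · exact (Continuous.integrableOn_uIoc (by fun_prop))
          · calc _ ≤ K * ((K * |r - s|) ^ n / n.factorial) := by
                  refine (norm_mul_le _ _).trans ?_
                  gcongr
                  · exact hK r
                  · exact ih r
              _ = _ := by ring
      _ = _ := by
          rw [MeasureTheory.integral_const_mul, integral_pow_abs_sub_uIoc, Nat.factorial_succ]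
          push_cast
          field_simp
          ring

variable [NormOneClass 𝔸] [CompleteSpace 𝔸]

theorem summable_dysonTerm (hM : Continuous M) (hK : ∀ t, ‖M t‖ ≤ K) (s t : ℝ) :
    Summable fun n => dysonTerm M s n t :=
  .of_norm_bounded (Real.summable_pow_div_factorial _) fun n => norm_dysonTerm_le hM hK s n t

/-- The Dyson series is dominated by an exponential series, and so are the derivatives of its terms
on balls around s; hence it can be differentiated term by term. -/
theorem exists_hasDerivAt_mul_of_bounded (hM : Continuous M) (hK : ∀ t, ‖M t‖ ≤ K) (s : ℝ) :
    ∃ V : ℝ → 𝔸, V s = 1 ∧ ∀ t, HasDerivAt V (M t * V t) t := by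
  have hK0 : 0 ≤ K := (norm_nonneg _).trans (hK 0)
  refine ⟨fun t => ∑' n, dysonTerm M s n t, ?_, fun t => ?_⟩
  · change ∑' n, dysonTerm M s n s = 1
    rw [tsum_eq_single 0]
    · rfl
    · intro n hn
      obtain ⟨k, rfl⟩ := Nat.exists_eq_succ_of_ne_zero hn
      exact intervalIntegral.integral_same
  · let g' : ℕ → ℝ → 𝔸 := fun n t => match n with
      | 0 => 0
      | n + 1 => M t * dysonTerm M s n t
    let R := |t - s| + 1
    let u : ℕ → ℝ := fun n => match n with
      | 0 => 0
      | n + 1 => K * ((K * R) ^ n / n.factorial)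
    have hu : Summable u := by
      rw [← summable_nat_add_iff 1]
      exact (Real.summable_pow_div_factorial _).mul_left K
    have hsum := hasDerivAt_tsum_of_isPreconnected (g := dysonTerm M s) (g' := g') (u := u)
      (t := Metric.ball s R) (y := t) (y₀ := t) hu Metric.isOpen_ball
      (convex_ball s R).isPreconnected ?_ ?_ ?_ (summable_dysonTerm hM hK s t) ?_
    · have hg' : ∑' n, g' n t = M t * ∑' n, dysonTerm M s n t := by
        rw [Summable.tsum_eq_zero_add]
        · simp only [g', zero_add]
          exact (summable_dysonTerm hM hK s t).tsum_mul_left _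
        · rw [← summable_nat_add_iff 1]
          exact (summable_dysonTerm hM hK s t).mul_left _
      rwa [hg'] at hsum
    · intro n y _
      cases n with
      | zero => exact hasDerivAt_const y (1 : 𝔸)
      | succ n => exact hasDerivAt_dysonTerm_succ hM s n y
    · intro n y hy
      cases n with
      | zero => simp [g', u]
      | succ n =>
        have hy' : |y - s| ≤ R := (Metric.mem_ball.mp hy).le
        refine (norm_mul_le _ _).trans ?_
        simp only [u]
        gcongr
        · exact hK y
        · exact (norm_dysonTerm_le hM hK s n y).trans (by gcongr)
    · simp [R, Real.dist_eq]
    · simp [R, Real.dist_eq]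

end Dyson

/-- The propagator of `i ψ' = M(t) ψ` for bounded self-adjoint operators `M(t)`. -/
theorem exists_unitary_propagator {E : Type*} [NormedAddCommGroup E] [InnerProductSpace ℂ E]
    [CompleteSpace E] {M : ℝ → E →L[ℂ] E} {K : ℝ} (hM : Continuous M) (hK : ∀ t, ‖M t‖ ≤ K)
    (hsa : ∀ t, IsSelfAdjoint (M t)) :
    ∃ U : ℝ → ℝ → E →L[ℂ] E,
      (∀ t s, HasDerivAt (fun t => U t s) ((-Complex.I) • (M t * U t s)) t) ∧
      (∀ s, U s s = 1) ∧ (∀ t r s, U t r * U r s = U t s) ∧ ∀ t s, star (U t s) = U s t := by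
  -- On the zero space the identity has norm 0, so the Dyson estimate, which needs ‖1‖ = 1, is
  -- bypassed.
  rcases subsingleton_or_nontrivial E with hE | hE
  · exact ⟨fun _ _ => 1, fun t s => by
      rw [Subsingleton.elim ((-Complex.I) • (M t * 1)) 0]; exact hasDerivAt_const _ _,
      fun _ => rfl, fun _ _ _ => Subsingleton.elim _ _, fun _ _ => Subsingleton.elim _ _⟩
  have hN : Continuous fun t => (-Complex.I) • M t := by fun_prop
  have hNK : ∀ t, ‖(-Complex.I) • M t‖ ≤ K := fun t => by simpa [norm_smul] using hK t
  choose V hV0 hV using exists_hasDerivAt_mul_of_bounded hN hNK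
  have hV' : ∀ t s, HasDerivAt (V s) ((-Complex.I) • (M t * V s t)) t := fun t s => by
    simpa [smul_mul_assoc] using hV s t
  have hgroup : ∀ t r s, V r t * V s r = V s t := by
    intro t r s
    have hlip : ∀ t, LipschitzOnWith K.toNNReal
        (fun X : E →L[ℂ] E => ((-Complex.I) • M t) * X) Set.univ := fun t => by
      refine LipschitzOnWith.of_dist_le_mul fun X _ Y _ => ?_
      rw [dist_eq_norm, dist_eq_norm, ← mul_sub]
      refine (norm_mul_le _ _).trans ?_
      gcongr
      exact (hNK t).trans (Real.le_coe_toNNReal K)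
    have := ODE_solution_unique_univ (t₀ := r) hlip (f := fun t => V r t * V s r) (g := V s)
      (fun t => ⟨by simpa [mul_assoc] using (hV r t).mul_const (V s r), trivial⟩)
      (fun t => ⟨hV s t, trivial⟩) (by simp [hV0])
    exact congrFun this t
  have hstar : ∀ t s, star (V s t) * V s t = 1 := by
    intro t s
    have hd : ∀ t, HasDerivAt (fun t => star (V s t) * V s t) 0 t := fun t => by
      have h := (hV' t s).star.mul (hV' t s)
      have h0 : star ((-Complex.I) • (M t * V s t)) * V s t +
          star (V s t) * ((-Complex.I) • (M t * V s t)) = 0 := by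
        rw [star_smul, star_mul, (hsa t).star_eq]
        simp [mul_assoc]
      rw [h0] at h
      exact h
    have := is_const_of_deriv_eq_zero (fun t => (hd t).differentiableAt)
      (fun t => (hd t).deriv) t s
    rw [this, hV0, star_one, one_mul]
  refine ⟨fun t s => V s t, hV', hV0, hgroup, fun t s => ?_⟩
  calc star (V s t) = star (V s t) * (V s t * V t s) := by rw [hgroup, hV0, mul_one]
    _ = V t s := by rw [← mul_assoc, hstar, one_mul]

/-! ### Duality and commutator identities -/

namespace PositiveSelfAdjoint

variable {E : Type*} [NormedAddCommGroup E] [InnerProductSpace ℂ E] [CompleteSpace E]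

/-- If `‖P V x‖ ≤ C ‖P x‖` for an injective self-adjoint operator `P`, then `V*` maps the range of
`P` into itself. -/
theorem _root_.IsSelfAdjoint.exists_star_mul_eq_mul {P V : E →L[ℂ] E} (hP : IsSelfAdjoint P)
    (hinj : Function.Injective P) {C : ℝ} (hC : 0 ≤ C) (h : ∀ x, ‖P (V x)‖ ≤ C * ‖P x‖) :
    ∃ T : E →L[ℂ] E, ‖T‖ ≤ C ∧ star V * P = P * T := by
  have hd : DenseRange P.toLinearMap := hP.denseRange_of_injective hinj
  -- The map Px ↦ PVx is bounded on the dense range of P; the adjoint of its extension is the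
  -- required T.
  let S : E →L[ℂ] E := (P * V).toLinearMap.extendOfNorm P.toLinearMap
  have hS : S * P = P * V := by
    ext x
    exact LinearMap.extendOfNorm_eq hd ⟨C, h⟩ x
  have hSn : ‖S‖ ≤ C := LinearMap.opNorm_extendOfNorm_le hd hC h
  refine ⟨star S, by rwa [norm_star], ?_⟩
  have := congrArg star hS
  rw [star_mul, star_mul, hP.star_eq] at this
  exact this.symm

theorem inv_pow_mul_cutoff (H : PositiveSelfAdjoint E) {ε : ℝ≥0} (hε : 0 < ε) (m : ℕ) :
    H.inv ^ m * H.cutoff ε m = H.cutoff ε 0 := by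
  rw [← negPow_natCast, H.negPow_mul_cutoff hε]

theorem cutoff_mul_inv_pow (H : PositiveSelfAdjoint E) (ε r : ℝ≥0) (n : ℕ) :
    H.cutoff ε r * H.inv ^ n = H.inv ^ n * H.cutoff ε r := by
  rw [← negPow_natCast, H.cutoff_mul_negPow]

theorem isSelfAdjoint_inv_pow (H : PositiveSelfAdjoint E) (n : ℕ) : IsSelfAdjoint (H.inv ^ n) :=
  H.isSelfAdjoint_inv.pow n

theorem inv_pow_injective (H : PositiveSelfAdjoint E) (n : ℕ) :
    Function.Injective (H.inv ^ n : E →L[ℂ] E) := by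
  rw [← negPow_natCast]; exact H.negPow_injective _

theorem denseRange_inv_pow (H : PositiveSelfAdjoint E) (n : ℕ) :
    DenseRange (H.inv ^ n : E →L[ℂ] E) :=
  (H.isSelfAdjoint_inv_pow n).denseRange_of_injective (H.inv_pow_injective n)

theorem inv_pow_mul_left_cancel (H : PositiveSelfAdjoint E) (n : ℕ) {S T : E →L[ℂ] E}
    (h : H.inv ^ n * S = H.inv ^ n * T) : S = T := by
  ext x
  exact H.inv_pow_injective n (DFunLike.congr_fun h x)

theorem inv_pow_mul_right_cancel (H : PositiveSelfAdjoint E) (n : ℕ) {S T : E →L[ℂ] E}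
    (h : S * H.inv ^ n = T * H.inv ^ n) : S = T := by
  have h2 := (H.denseRange_inv_pow n).equalizer S.continuous T.continuous
    (funext fun x => DFunLike.congr_fun h x)
  exact DFunLike.coe_injective h2

/-- A single operator `L`, through `ℓ = L A^m` with `A = H⁻¹`, whose commutator
`[L, H] H⁻¹ = B 0` restricts to bounded operators `A^{-l} (B 0) A^l = B l`, `l ≤ N`. -/
structure SymmetricWithCommutator (H : PositiveSelfAdjoint E) (m N : ℕ) (ℓ : E →L[ℂ] E)
    (B : ℕ → E →L[ℂ] E) : Prop where
  symm : IsSelfAdjoint (H.inv ^ m * ℓ)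
  intertwine : ∀ l ≤ N, B 0 * H.inv ^ l = H.inv ^ l * B l
  comm : H.inv * ℓ - ℓ * H.inv = H.inv * B 0 * H.inv ^ m

namespace SymmetricWithCommutator

variable {H : PositiveSelfAdjoint E} {m N : ℕ} {ℓ : E →L[ℂ] E} {B : ℕ → E →L[ℂ] E}

/-- Formally A B₀ = AL − LA with A self-adjoint and L symmetric, hence it is skew-adjoint. The
computation is sandwiched between two factors A^m to stay with bounded operators, and these are
cancelled by injectivity and dense range. -/
theorem inv_mul_commutator (h : SymmetricWithCommutator H m N ℓ B) :
    H.inv * B 0 = -(star (B 0) * H.inv) := by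
  have hA := H.isSelfAdjoint_inv
  have hX := h.symm
  have e1 : H.inv ^ m * (H.inv * B 0) * H.inv ^ m =
      H.inv * (H.inv ^ m * ℓ) - (H.inv ^ m * ℓ) * H.inv := by
    rw [mul_assoc, ← h.comm, mul_sub, ← mul_assoc, ← mul_assoc, ← mul_assoc, ← pow_succ, ← pow_succ']
  have e2 := congrArg star e1
  simp only [star_sub, star_mul, hX.star_eq, hA.star_eq, (H.isSelfAdjoint_inv_pow m).star_eq] at e2
  refine H.inv_pow_mul_left_cancel m (H.inv_pow_mul_right_cancel m ?_)
  rw [e1, mul_neg, neg_mul, mul_assoc (H.inv ^ m) (star (B 0) * H.inv), e2]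
  abel

/-- Telescoping: each factor A commuted past ℓ contributes −B₀* A^{m+1}, and the powers standing to
its left are carried through by A^l B₀* = B_l* A^l. The sum stops at j − 1, so bounds on B_l for l ≤
N reach the exponent j = N + 1. -/
theorem inv_pow_commutator (h : SymmetricWithCommutator H m N ℓ B) {j : ℕ} (hj : j ≤ N + 1) :
    H.inv ^ j * ℓ - ℓ * H.inv ^ j =
      -((∑ l ∈ Finset.range j, star (B l)) * H.inv ^ (j + m)) := by
  induction j with
  | zero => simp
  | succ j ih =>
    have hB : H.inv ^ j * star (B 0) = star (B j) * H.inv ^ j := by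
      have := congrArg star (h.intertwine j (by omega))
      simpa only [star_mul, (H.isSelfAdjoint_inv_pow j).star_eq] using this
    have p1 : H.inv ^ (j + 1) * H.inv ^ m = H.inv ^ (j + 1 + m) := (pow_add _ _ _).symm
    have p2 : H.inv ^ (j + m) * H.inv = H.inv ^ (j + 1 + m) := by
      rw [← pow_succ, show j + m + 1 = j + 1 + m by ring]
    have e1 : H.inv ^ (j + 1) * ℓ - ℓ * H.inv ^ (j + 1) =
        H.inv ^ j * (H.inv * ℓ - ℓ * H.inv) + (H.inv ^ j * ℓ - ℓ * H.inv ^ j) * H.inv := by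
      rw [pow_succ]; noncomm_ring
    rw [e1, h.comm, h.inv_mul_commutator, ih (by omega), neg_mul, mul_neg, ← mul_assoc, ← mul_assoc,
      hB, Finset.sum_range_succ, add_mul, neg_add, neg_mul, mul_assoc _ _ H.inv, ← pow_succ,
      mul_assoc, mul_assoc, p1, p2, add_comm]

theorem mul_inv_eq (h : SymmetricWithCommutator H m N ℓ B) :
    ℓ * H.inv = H.inv * (ℓ - B 0 * H.inv ^ m) := by
  rw [mul_sub, ← mul_assoc, ← h.comm]; abel

end SymmetricWithCommutator

/-! ### Mollified operators -/

/-- The bounded approximation `J L J` of `L`, where `J` is the cutoff of `H` at `1/ε`. -/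
def mollify (H : PositiveSelfAdjoint E) (m : ℕ) (ε : ℝ≥0) (ℓ : E →L[ℂ] E) : E →L[ℂ] E :=
  H.cutoff ε m * (H.inv ^ m * ℓ) * H.cutoff ε m

theorem mollify_eq (H : PositiveSelfAdjoint E) {ε : ℝ≥0} (hε : 0 < ε) (m : ℕ) (ℓ : E →L[ℂ] E) :
    H.mollify m ε ℓ = H.cutoff ε 0 * ℓ * H.cutoff ε m := by
  rw [mollify, ← mul_assoc, cutoff_mul_inv_pow, H.inv_pow_mul_cutoff hε]

theorem mollify_mul_inv_pow (H : PositiveSelfAdjoint E) {ε : ℝ≥0} (hε : 0 < ε) (m : ℕ)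
    (ℓ : E →L[ℂ] E) : H.mollify m ε ℓ * H.inv ^ m = H.cutoff ε 0 * ℓ * H.cutoff ε 0 := by
  rw [H.mollify_eq hε, mul_assoc, cutoff_mul_inv_pow, H.inv_pow_mul_cutoff hε]

theorem norm_mollify_mul_inv_pow_le (H : PositiveSelfAdjoint E) {ε : ℝ≥0} (hε : 0 < ε) (m : ℕ)
    (ℓ : E →L[ℂ] E) : ‖H.mollify m ε ℓ * H.inv ^ m‖ ≤ ‖ℓ‖ := by
  rw [H.mollify_mul_inv_pow hε]
  calc _ ≤ ‖H.cutoff ε 0‖ * ‖ℓ‖ * ‖H.cutoff ε 0‖ := norm_mul₃_le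
    _ ≤ 1 * ‖ℓ‖ * 1 := by gcongr <;> exact H.norm_cutoff_zero_le ε
    _ = _ := by ring

/-- On the range of A^m the mollified operator is JℓJ, which converges strongly but without a rate;
this suffices to pass to the limit in the weak equation. -/
theorem tendsto_mollify (H : PositiveSelfAdjoint E) (m : ℕ) (ℓ : E →L[ℂ] E) (z : E) :
    Tendsto (fun n : ℕ => H.mollify m (1 / (n + 1 : ℝ≥0)) ℓ ((H.inv ^ m) z)) atTop (𝓝 (ℓ z)) := by
  have hJ : ∀ n : ℕ, H.mollify m (1 / (n + 1 : ℝ≥0)) ℓ ((H.inv ^ m) z) =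
      H.cutoff (1 / (n + 1 : ℝ≥0)) 0 (ℓ (H.cutoff (1 / (n + 1 : ℝ≥0)) 0 z - z)) +
      H.cutoff (1 / (n + 1 : ℝ≥0)) 0 (ℓ z) := fun n => by
    have := DFunLike.congr_fun (H.mollify_mul_inv_pow (ε := 1 / (n + 1 : ℝ≥0)) (by positivity) m ℓ) z
    simp only [mul_apply_eq_comp] at this
    rw [this, ← map_add, ← map_add, sub_add_cancel]
  simp_rw [hJ]
  rw [← zero_add (ℓ z)]
  refine Tendsto.add ?_ (by simpa using H.tendsto_cutoff (ℓ z))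
  have h1 : Tendsto (fun n : ℕ => ‖ℓ (H.cutoff (1 / (n + 1 : ℝ≥0)) 0 z - z)‖) atTop (𝓝 0) := by
    have := (ℓ.continuous.tendsto _).comp ((H.tendsto_cutoff z).sub_const z)
    simpa using this.norm
  refine squeeze_zero_norm (fun n => ?_) h1
  simpa using (H.cutoff (1 / (n + 1 : ℝ≥0)) 0).le_of_opNorm_le (H.norm_cutoff_zero_le _)
    (ℓ (H.cutoff (1 / (n + 1 : ℝ≥0)) 0 z - z))

namespace SymmetricWithCommutator

variable {H : PositiveSelfAdjoint E} {m N : ℕ} {ℓ : E →L[ℂ] E} {B : ℕ → E →L[ℂ] E}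

theorem isSelfAdjoint_mollify (h : SymmetricWithCommutator H m N ℓ B) (ε : ℝ≥0) :
    IsSelfAdjoint (H.mollify m ε ℓ) := by
  have := h.symm.conjugate (H.cutoff ε m)
  rwa [(H.isSelfAdjoint_cutoff ε m).star_eq] at this

/-- One factor A beyond A^m converts J → 1 into the rate ε. On the right of ℓ it meets J directly;
for the J on the left it is first moved across by ℓA = A(ℓ − B₀ A^m). -/
theorem norm_mollify_sub_le (h : SymmetricWithCommutator H m N ℓ B) {ε : ℝ≥0} (hε : 0 < ε)
    {K b : ℝ} (hK : ‖ℓ‖ ≤ K) (hb : ‖B 0‖ ≤ b) :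
    ‖H.mollify m ε ℓ * H.inv ^ (m + 1) - ℓ * H.inv‖ ≤ (2 * K + b * ‖H.inv‖ ^ m) * ε := by
  have hJ : H.cutoff ε 0 * H.inv = H.inv * H.cutoff ε 0 := by
    simpa using H.cutoff_mul_inv_pow ε 0 1
  have hJ1 := H.norm_inv_sub_cutoff_le hε
  have e : H.mollify m ε ℓ * H.inv ^ (m + 1) - ℓ * H.inv =
      -(H.cutoff ε 0 * ℓ * (H.inv - H.inv * H.cutoff ε 0)) -
        (H.inv - H.inv * H.cutoff ε 0) * (ℓ - B 0 * H.inv ^ m) := by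
    have e2 : (H.inv - H.inv * H.cutoff ε 0) * (ℓ - B 0 * H.inv ^ m) =
        ℓ * H.inv - H.cutoff ε 0 * (ℓ * H.inv) := by
      rw [← hJ, sub_mul, mul_assoc, ← h.mul_inv_eq]
    rw [e2, pow_succ, ← mul_assoc, H.mollify_mul_inv_pow hε, mul_assoc _ (H.cutoff ε 0) H.inv, hJ]
    noncomm_ring
  rw [e]
  have hK0 : 0 ≤ K := (norm_nonneg _).trans hK
  have hb0 : 0 ≤ b := (norm_nonneg _).trans hb
  have h1 : ‖ℓ - B 0 * H.inv ^ m‖ ≤ K + b * ‖H.inv‖ ^ m := by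
    refine (norm_sub_le _ _).trans (add_le_add hK ((norm_mul_le _ _).trans ?_))
    gcongr
    rcases Nat.eq_zero_or_pos m with rfl | hm
    · rw [pow_zero, pow_zero]; exact ContinuousLinearMap.norm_id_le
    · exact norm_pow_le' _ hm
  calc _ ≤ ‖H.cutoff ε 0‖ * ‖ℓ‖ * ‖H.inv - H.inv * H.cutoff ε 0‖ +
        ‖H.inv - H.inv * H.cutoff ε 0‖ * ‖ℓ - B 0 * H.inv ^ m‖ := by
        refine (norm_sub_le _ _).trans (add_le_add ?_ (norm_mul_le _ _))
        rw [norm_neg]; exact norm_mul₃_le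
    _ ≤ 1 * K * ε + ε * (K + b * ‖H.inv‖ ^ m) := by
        gcongr
        exact H.norm_cutoff_zero_le ε
    _ = _ := by ring

/-- Moving A^j inside leaves a symmetric main term ⟨A^m y, ℓy⟩ with y = A^j G ψ, which is real, and
a remainder −J D* J A^j ψ. Contractivity of J makes the constant independent of ε. -/
theorem abs_im_inner_mollify_le (h : SymmetricWithCommutator H m N ℓ B) {ε : ℝ≥0} (hε : 0 < ε)
    {j : ℕ} (hj : j ≤ N + 1) {C : ℝ} (hC : ‖∑ l ∈ Finset.range j, B l‖ ≤ C) (ψ : E) :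
    |(⟪(H.inv ^ j) ψ, (H.inv ^ j) (H.mollify m ε ℓ ψ)⟫_ℂ).im| ≤ C * ‖(H.inv ^ j) ψ‖ ^ 2 := by
  set J := H.cutoff ε 0
  set G := H.cutoff ε m
  set D := ∑ l ∈ Finset.range j, B l
  have e : H.inv ^ j * H.mollify m ε ℓ =
      J * (ℓ * (H.inv ^ j * G)) - J * (star D * (J * H.inv ^ j)) := by
    have h1 : H.inv ^ j * ℓ = ℓ * H.inv ^ j - star D * H.inv ^ (j + m) := by
      rw [eq_sub_iff_add_eq, ← eq_sub_iff_add_eq', ← neg_sub, h.inv_pow_commutator hj, neg_neg,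
        star_sum]
    have h2 : H.inv ^ (j + m) * G = J * H.inv ^ j := by
      rw [pow_add, mul_assoc, H.inv_pow_mul_cutoff hε, cutoff_mul_inv_pow]
    rw [H.mollify_eq hε, ← mul_assoc, ← mul_assoc, ← cutoff_mul_inv_pow, mul_assoc J, h1, ← h2]
    noncomm_ring
  have e' := DFunLike.congr_fun e ψ
  simp only [mul_apply_eq_comp, sub_apply] at e'
  have hJsa : IsSelfAdjoint J := H.isSelfAdjoint_cutoff ε 0
  have hJA : J ((H.inv ^ j) ψ) = (H.inv ^ m) ((H.inv ^ j) (G ψ)) := by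
    have : J * H.inv ^ j = H.inv ^ m * (H.inv ^ j * G) := by
      rw [← mul_assoc, ← pow_add, add_comm, pow_add, mul_assoc, H.inv_pow_mul_cutoff hε,
        cutoff_mul_inv_pow]
    exact DFunLike.congr_fun this ψ
  have hreal : ∀ y : E, (⟪(H.inv ^ m) y, ℓ y⟫_ℂ).im = 0 := fun y => by
    rw [(H.isSelfAdjoint_inv_pow m).inner_apply_left]
    have := h.symm.inner_apply_left y y
    rw [← Complex.conj_eq_iff_im, inner_conj_symm]
    exact this
  have hn : ‖J ((H.inv ^ j) ψ)‖ ≤ ‖(H.inv ^ j) ψ‖ := by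
    simpa using J.le_of_opNorm_le (H.norm_cutoff_zero_le ε) ((H.inv ^ j) ψ)
  rw [e', inner_sub_right, ← hJsa.inner_apply_left, ← hJsa.inner_apply_left, Complex.sub_im]
  conv_lhs => rw [hJA]
  rw [hreal, zero_sub, abs_neg, ← hJA]
  have hC0 : 0 ≤ C := (norm_nonneg _).trans hC
  calc _ ≤ ‖J ((H.inv ^ j) ψ)‖ * (C * ‖J ((H.inv ^ j) ψ)‖) := by
        refine (Complex.abs_im_le_norm _).trans ((norm_inner_le_norm _ _).trans ?_)
        gcongr
        exact (star D).le_of_opNorm_le (by rwa [norm_star]) _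
    _ = C * ‖J ((H.inv ^ j) ψ)‖ ^ 2 := by ring
    _ ≤ _ := by gcongr

end SymmetricWithCommutator

end PositiveSelfAdjoint

/-! ### Energy estimates and unitary evolutions -/

/-- Energy estimate for `i ψ' = φ`. -/
theorem norm_le_exp_mul_norm_of_abs_im_inner_le {E : Type*} [NormedAddCommGroup E]
    [InnerProductSpace ℂ E] {ψ φ : ℝ → E} {P : E →L[ℂ] E} {C : ℝ}
    (hψ : ∀ t, HasDerivAt ψ ((-Complex.I) • φ t) t)
    (hC : ∀ t, |(⟪P (ψ t), P (φ t)⟫_ℂ).im| ≤ C * ‖P (ψ t)‖ ^ 2) (t s : ℝ) :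
    ‖P (ψ t)‖ ≤ Real.exp (C * |t - s|) * ‖P (ψ s)‖ := by
  have hg : ∀ t, HasDerivAt (fun t => ‖P (ψ t)‖ ^ 2) (2 * (⟪P (ψ t), P (φ t)⟫_ℂ).im) t := by
    intro t
    have h1 : HasDerivAt (fun t => P (ψ t)) (P ((-Complex.I) • φ t)) t :=
      (P.restrictScalars ℝ).hasFDerivAt.comp_hasDerivAt t (hψ t)
    have h2 := Complex.reCLM.hasFDerivAt.comp_hasDerivAt t (h1.inner ℂ h1)
    rw [map_smul, inner_smul_right, inner_smul_left, ← inner_conj_symm (P (φ t))] at h2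
    convert! h2 using 1
    · funext t
      exact norm_sq_eq_re_inner (𝕜 := ℂ) _
    · generalize ⟪P (ψ t), P (φ t)⟫_ℂ = z
      simp [two_mul]
  have hpos := fun t => abs_le.mp (hC t)
  have hexp : ∀ a t : ℝ, HasDerivAt (fun t => Real.exp (a * t)) (Real.exp (a * t) * a) t :=
    fun a t => by simpa using ((hasDerivAt_id t).const_mul a).exp
  have hd := fun a t => (hexp a t).mul (hg t)
  have hsq : ‖P (ψ t)‖ ^ 2 ≤ (Real.exp (C * |t - s|) * ‖P (ψ s)‖) ^ 2 := by
    have hsplit : ∀ a : ℝ, Real.exp (a * s) = Real.exp (a * t) * Real.exp (a * (s - t)) :=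
      fun a => by rw [← Real.exp_add]; ring_nf
    rw [mul_pow, ← Real.exp_nat_mul]
    -- Grönwall by monotonicity: e^{−2Ct}‖Pψ‖² decreases and e^{2Ct}‖Pψ‖² increases, which covers
    -- both directions of time.
    rcases le_total s t with hst | hst
    · have hanti := antitone_of_deriv_nonpos (fun t => (hd (-(2 * C)) t).differentiableAt)
        (fun t => by
          rw [(hd _ t).deriv]
          have := Real.exp_pos (-(2 * C) * t)
          nlinarith [hpos t])
      have h3 := hanti hst
      simp only [Pi.mul_apply] at h3
      rw [hsplit, mul_assoc (Real.exp _)] at h3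
      have h4 := le_of_mul_le_mul_left h3 (Real.exp_pos _)
      rw [abs_of_nonneg (sub_nonneg.mpr hst)]
      refine h4.trans (le_of_eq ?_)
      congr 2
      push_cast; ring
    · have hmono := monotone_of_deriv_nonneg (fun t => (hd (2 * C) t).differentiableAt)
        (fun t => by
          rw [(hd _ t).deriv]
          have := Real.exp_pos ((2 * C) * t)
          nlinarith [hpos t])
      have h3 := hmono hst
      simp only [Pi.mul_apply] at h3
      rw [hsplit, mul_assoc (Real.exp _)] at h3
      have h4 := le_of_mul_le_mul_left h3 (Real.exp_pos _)
      rw [abs_of_nonpos (sub_nonpos.mpr hst)]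
      refine h4.trans (le_of_eq ?_)
      congr 2
      push_cast; ring
  exact (sq_le_sq₀ (norm_nonneg _) (by positivity)).mp hsq

theorem HasDerivAt.clm_apply_vec {E F : Type*} [NormedAddCommGroup E] [NormedSpace ℂ E]
    [NormedAddCommGroup F] [NormedSpace ℂ F] {u : ℝ → E →L[ℂ] F}
    {u' : E →L[ℂ] F} {t : ℝ} (hu : HasDerivAt u u' t) (x : E) :
    HasDerivAt (fun t => u t x) (u' x) t :=
  ((ContinuousLinearMap.apply ℂ F x).restrictScalars ℝ).hasFDerivAt.comp_hasDerivAt t hu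

/-- A two-parameter family of unitary operators with the group property. -/
structure IsUnitaryEvolution {E : Type*} [NormedAddCommGroup E] [InnerProductSpace ℂ E]
    [CompleteSpace E] (U : ℝ → ℝ → E →L[ℂ] E) : Prop where
  refl : ∀ s, U s s = 1
  trans : ∀ t r s, U t r * U r s = U t s
  star_eq : ∀ t s, star (U t s) = U s t

namespace IsUnitaryEvolution

variable {E : Type*} [NormedAddCommGroup E] [InnerProductSpace ℂ E] [CompleteSpace E]
  {U : ℝ → ℝ → E →L[ℂ] E}

theorem mem_unitary (hU : IsUnitaryEvolution U) (t s : ℝ) : U t s ∈ unitary (E →L[ℂ] E) := by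
  rw [Unitary.mem_iff, hU.star_eq, hU.trans, hU.trans, hU.refl, hU.refl]
  exact ⟨rfl, rfl⟩

theorem apply_apply (hU : IsUnitaryEvolution U) (t r s : ℝ) (x : E) :
    U t r (U r s x) = U t s x := by
  rw [← hU.trans t r s]; rfl

theorem refl_apply (hU : IsUnitaryEvolution U) (s : ℝ) (x : E) : U s s x = x := by
  rw [hU.refl]; rfl

theorem inner_apply_left (hU : IsUnitaryEvolution U) (t s : ℝ) (x y : E) :
    ⟪U t s x, y⟫_ℂ = ⟪x, U s t y⟫_ℂ := by
  rw [← hU.star_eq, ContinuousLinearMap.star_eq_adjoint, ContinuousLinearMap.adjoint_inner_left]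

theorem norm_apply (hU : IsUnitaryEvolution U) (t s : ℝ) (x : E) : ‖U t s x‖ = ‖x‖ := by
  rw [← sq_eq_sq₀ (norm_nonneg _) (norm_nonneg _), norm_sq_eq_re_inner (𝕜 := ℂ),
    norm_sq_eq_re_inner (𝕜 := ℂ), hU.inner_apply_left, hU.apply_apply, hU.refl_apply]

end IsUnitaryEvolution

/-! ### The limit evolution -/

namespace PositiveSelfAdjoint

variable {E : Type*} [NormedAddCommGroup E] [InnerProductSpace ℂ E] [CompleteSpace E]

/-- A bounded continuous family of operators `L(t)`, through `ℓ(t) = L(t) A^m` with `A = H⁻¹`,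
whose commutators `[L(t), H] H⁻¹` restrict to uniformly bounded operators on `H^{2l}`, `l ≤ N`. -/
structure CommutatorFamily (H : PositiveSelfAdjoint E) (m N : ℕ) (ℓ : ℝ → E →L[ℂ] E)
    (B : ℕ → ℝ → E →L[ℂ] E) : Prop where
  le : m ≤ N
  continuous : Continuous ℓ
  bounded : ∃ K, ∀ t, ‖ℓ t‖ ≤ K
  comm_bounded : ∀ l ≤ N, ∃ b, ∀ t, ‖B l t‖ ≤ b
  symm : ∀ t, SymmetricWithCommutator H m N (ℓ t) fun l => B l t

namespace CommutatorFamily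

variable {H : PositiveSelfAdjoint E} {m N : ℕ} {ℓ : ℝ → E →L[ℂ] E} {B : ℕ → ℝ → E →L[ℂ] E}

theorem exists_norm_sum_le (h : CommutatorFamily H m N ℓ B) {j : ℕ} (hj : j ≤ N + 1) :
    ∃ C, 0 ≤ C ∧ ∀ t, ‖∑ l ∈ Finset.range j, B l t‖ ≤ C := by
  have hb : ∀ l, ∃ b, l ≤ N → ∀ t, ‖B l t‖ ≤ b := fun l => by
    by_cases hl : l ≤ N
    · obtain ⟨b, hb⟩ := h.comm_bounded l hl
      exact ⟨b, fun _ => hb⟩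
    · exact ⟨0, fun h => absurd h hl⟩
  choose b hb using hb
  have hle : ∀ t, ‖∑ l ∈ Finset.range j, B l t‖ ≤ ∑ l ∈ Finset.range j, b l := fun t =>
    norm_sum_le_of_le _ fun l hl => hb l (by rw [Finset.mem_range] at hl; omega) t
  exact ⟨_, (norm_nonneg _).trans (hle 0), hle⟩

theorem exists_mollified_evolution (h : CommutatorFamily H m N ℓ B) {ε : ℝ≥0} (hε : 0 < ε) :
    ∃ U : ℝ → ℝ → E →L[ℂ] E, IsUnitaryEvolution U ∧
      (∀ t s, HasDerivAt (fun t => U t s) ((-Complex.I) • (H.mollify m ε (ℓ t) * U t s)) t) ∧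
      ∀ j ≤ N + 1, ∀ C, (∀ t, ‖∑ l ∈ Finset.range j, B l t‖ ≤ C) → ∀ t s x,
        ‖(H.inv ^ j) (U t s x)‖ ≤ Real.exp (C * |t - s|) * ‖(H.inv ^ j) x‖ := by
  obtain ⟨K, hK⟩ := h.bounded
  have hK0 : 0 ≤ K := (norm_nonneg _).trans (hK 0)
  have hcont : Continuous fun t => H.mollify m ε (ℓ t) := by
    have := h.continuous
    unfold mollify
    fun_prop
  have hbdd : ∀ t, ‖H.mollify m ε (ℓ t)‖ ≤ ‖H.cutoff ε 0‖ * K * ‖H.cutoff ε m‖ := fun t => by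
    rw [H.mollify_eq hε]
    refine norm_mul₃_le.trans ?_
    gcongr
    exact hK t
  obtain ⟨U, hd, h1, h2, h3⟩ := exists_unitary_propagator hcont hbdd
    fun t => (h.symm t).isSelfAdjoint_mollify ε
  refine ⟨U, ⟨h1, h2, h3⟩, hd, fun j hj C hC t s x => ?_⟩
  have hψ : ∀ t, HasDerivAt (fun t => U t s x)
      ((-Complex.I) • H.mollify m ε (ℓ t) (U t s x)) t := fun t =>
    HasDerivAt.clm_apply_vec (hd t s) x
  have := norm_le_exp_mul_norm_of_abs_im_inner_le (P := H.inv ^ j) hψ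
    (fun t => (h.symm t).abs_im_inner_mollify_le hε hj (hC t) (U t s x)) t s
  rwa [h1] at this

end CommutatorFamily

/-- Duhamel: r ↦ U(r,s)* V(r,s)x has derivative i U(s,r)(M − M')V(r,s)x, and U is isometric. Only
the orbit of V has to lie where M − M' is small. -/
theorem _root_.IsUnitaryEvolution.norm_sub_apply_le {U V : ℝ → ℝ → E →L[ℂ] E}
    {M M' : ℝ → E →L[ℂ] E} (hU : IsUnitaryEvolution U) (hV : IsUnitaryEvolution V)
    (hU' : ∀ t s, HasDerivAt (fun t => U t s) ((-Complex.I) • (M t * U t s)) t)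
    (hV' : ∀ t s, HasDerivAt (fun t => V t s) ((-Complex.I) • (M' t * V t s)) t)
    (hM : ∀ t, IsSelfAdjoint (M t)) (x : E) (t s : ℝ) {K : ℝ}
    (hK : ∀ r ∈ Set.uIcc s t, ‖(M r - M' r) (V r s x)‖ ≤ K) :
    ‖U t s x - V t s x‖ ≤ K * |t - s| := by
  have hz : ∀ r, HasDerivAt (fun r => star (U r s) (V r s x))
      (Complex.I • U s r ((M r - M' r) (V r s x))) r := fun r => by
    have h1 := HasDerivAt.clm_apply_vec ((hU' r s).star.mul (hV' r s)) x
    have h2 : (star ((-Complex.I) • (M r * U r s)) * V r s +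
        star (U r s) * ((-Complex.I) • (M' r * V r s))) x =
        Complex.I • U s r ((M r - M' r) (V r s x)) := by
      rw [star_smul, star_mul, (hM r).star_eq, hU.star_eq]
      simp [sub_eq_add_neg]
    rw [h2] at h1
    exact h1
  have h3 := (convex_uIcc s t).norm_image_sub_le_of_norm_hasDerivWithin_le
    (fun r _ => (hz r).hasDerivWithinAt) (C := K)
    (fun r hr => by
      rw [norm_smul, Complex.norm_I, one_mul, hU.norm_apply]
      exact hK r hr) Set.left_mem_uIcc Set.right_mem_uIcc
  simp only [hU.star_eq, hU.refl_apply, hV.refl_apply] at h3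
  have h4 : U t s x - V t s x = -U t s (U s t (V t s x) - x) := by
    rw [map_sub, hU.apply_apply, hU.refl_apply, neg_sub]
  rwa [h4, norm_neg, hU.norm_apply, ← Real.norm_eq_abs]

namespace CommutatorFamily

variable {H : PositiveSelfAdjoint E} {m N : ℕ} {ℓ : ℝ → E →L[ℂ] E} {B : ℕ → ℝ → E →L[ℂ] E}

/-- The approximate evolutions are Cauchy on the dense range of A^{m+1} and isometric, so they
converge strongly everywhere. The equation survives only tested against the range of A^m, where L
can be moved onto the test vector, because the orbit of a general w has no regularity. -/
theorem exists_unitaryEvolution (h : CommutatorFamily H m N ℓ B) :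
    ∃ U : ℝ → ℝ → E →L[ℂ] E, IsUnitaryEvolution U ∧
      (∀ x, Continuous fun p : ℝ × ℝ => U p.1 p.2 x) ∧
      (∀ j ≤ N + 1, ∃ C, 0 ≤ C ∧ ∀ t s x,
        ‖(H.inv ^ j) (U t s x)‖ ≤ Real.exp (C * |t - s|) * ‖(H.inv ^ j) x‖) ∧
      ∀ z w t s, ⟪(H.inv ^ m) z, U t s w⟫_ℂ - ⟪(H.inv ^ m) z, w⟫_ℂ =
        ∫ r in s..t, -Complex.I * ⟪ℓ r z, U r s w⟫_ℂ := by
  set ε : ℕ → ℝ≥0 := fun n => 1 / (n + 1 : ℝ≥0) with hεdef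
  have hε : ∀ n, 0 < ε n := fun n => by positivity
  have hε0 : Tendsto (fun n => (ε n : ℝ)) atTop (𝓝 0) := by
    simpa [hεdef] using tendsto_one_div_add_atTop_nhds_zero_nat (𝕜 := ℝ)
  choose V hV hV' hVbd using fun n => h.exists_mollified_evolution (hε n)
  -- The exponent m + 1 is the one at which mollification has a rate; it is admissible since m ≤ N.
  obtain ⟨C, hC0, hC⟩ := h.exists_norm_sum_le (j := m + 1) (by have := h.le; omega)
  obtain ⟨K, hK⟩ := h.bounded
  obtain ⟨b, hb⟩ := h.comm_bounded 0 (Nat.zero_le _)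
  set K' := 2 * K + b * ‖H.inv‖ ^ m
  have hK'0 : 0 ≤ K' := by
    have := (norm_nonneg _).trans (hK 0)
    have := (norm_nonneg _).trans (hb 0)
    positivity
  have hcauchy : ∀ n p t s y, ‖V n t s ((H.inv ^ (m + 1)) y) - V p t s ((H.inv ^ (m + 1)) y)‖ ≤
      (K' * (ε n + ε p)) * (Real.exp (C * |t - s|) * ‖y‖) * |t - s| := by
    intro n p t s y
    refine (hV n).norm_sub_apply_le (hV p) (hV' n) (hV' p)
      (fun t => (h.symm t).isSelfAdjoint_mollify _) _ t s fun r hr => ?_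
    -- The negative-norm bound for V(s,r), dualised, keeps the orbit V(r,s)A^{m+1}y in the range of
    -- A^{m+1} with a controlled preimage.
    obtain ⟨T, hT, hTe⟩ := (H.isSelfAdjoint_inv_pow (m + 1)).exists_star_mul_eq_mul
      (H.inv_pow_injective (m + 1)) (Real.exp_pos _).le
      (hVbd p (m + 1) (by have := h.le; omega) C hC s r)
    rw [(hV p).star_eq] at hTe
    have hTe' : V p r s ((H.inv ^ (m + 1)) y) = (H.inv ^ (m + 1)) (T y) :=
      DFunLike.congr_fun hTe y
    rw [hTe', ← mul_apply_eq_comp, sub_mul]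
    have hsub : ‖H.mollify m (ε n) (ℓ r) * H.inv ^ (m + 1) -
        H.mollify m (ε p) (ℓ r) * H.inv ^ (m + 1)‖ ≤ K' * (ε n + ε p) := by
      rw [← sub_sub_sub_cancel_right _ _ (ℓ r * H.inv), mul_add]
      exact (norm_sub_le _ _).trans (add_le_add
        ((h.symm r).norm_mollify_sub_le (hε n) (hK r) (hb r))
        ((h.symm r).norm_mollify_sub_le (hε p) (hK r) (hb r)))
    refine (ContinuousLinearMap.le_of_opNorm_le _ hsub _).trans ?_
    gcongr
    refine (T.le_of_opNorm_le hT y).trans ?_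
    gcongr 1
    refine Real.exp_le_exp.mpr (mul_le_mul_of_nonneg_left ?_ hC0)
    rw [abs_sub_comm s r]
    exact Set.abs_sub_left_of_mem_uIcc hr
  have hdense := H.denseRange_inv_pow (m + 1)
  have hlim : ∀ t s x, ∃ y, Tendsto (fun n => V n t s x) atTop (𝓝 y) := by
    intro t s x
    refine cauchySeq_tendsto_of_complete (Metric.cauchySeq_iff'.mpr fun δ hδ => ?_)
    obtain ⟨_, ⟨y, rfl⟩, hy⟩ := Metric.mem_closure_iff.mp (hdense x) (δ / 3) (by positivity)
    rw [dist_eq_norm] at hy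
    have hlim0 : Tendsto (fun n => (K' * (ε n + ε n)) * (Real.exp (C * |t - s|) * ‖y‖) * |t - s|)
        atTop (𝓝 0) := by
      simpa using (((hε0.add hε0).const_mul K').mul_const
        (Real.exp (C * |t - s|) * ‖y‖)).mul_const |t - s|
    obtain ⟨N₀, hN₀⟩ := (hlim0.eventually_lt_const
      (show (0 : ℝ) < δ / 3 by positivity)).exists
    refine ⟨N₀, fun n hn => ?_⟩
    have hεn : (ε n : ℝ) ≤ ε N₀ := by
      have : (N₀ : ℝ≥0) ≤ n := by exact_mod_cast hn
      simp only [hεdef]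
      gcongr
    have e : V n t s x - V N₀ t s x = V n t s (x - (H.inv ^ (m + 1)) y) +
        (V n t s ((H.inv ^ (m + 1)) y) - V N₀ t s ((H.inv ^ (m + 1)) y)) -
        V N₀ t s (x - (H.inv ^ (m + 1)) y) := by
      simp only [map_sub]; abel
    have h5 := hcauchy n N₀ t s y
    have h6 : (K' * (ε n + ε N₀)) * (Real.exp (C * |t - s|) * ‖y‖) * |t - s| ≤
        (K' * (ε N₀ + ε N₀)) * (Real.exp (C * |t - s|) * ‖y‖) * |t - s| := by gcongr
    rw [dist_eq_norm, e]
    refine (norm_sub_le _ _).trans_lt ?_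
    rw [(hV N₀).norm_apply]
    have h7 := norm_add_le (V n t s (x - (H.inv ^ (m + 1)) y))
      (V n t s ((H.inv ^ (m + 1)) y) - V N₀ t s ((H.inv ^ (m + 1)) y))
    rw [(hV n).norm_apply] at h7
    linarith
  choose Ulim hUlim using hlim
  let U : ℝ → ℝ → E →L[ℂ] E := fun t s =>
    continuousLinearMapOfTendsto (fun n => V n t s) (tendsto_pi_nhds.mpr fun x => hUlim t s x)
  have hU : ∀ t s x, Tendsto (fun n => V n t s x) atTop (𝓝 (U t s x)) := hUlim
  have hev : IsUnitaryEvolution U := by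
    refine ⟨fun s => ?_, fun t r s => ?_, fun t s => ?_⟩
    · ext x
      refine tendsto_nhds_unique (hU s s x) ?_
      simp only [(hV _).refl_apply]
      exact tendsto_const_nhds
    · ext x
      refine tendsto_nhds_unique (f := fun n => V n t r (V n r s x)) (l := atTop) ?_ ?_
      · have e : ∀ n, V n t r (V n r s x) =
            V n t r (V n r s x - U r s x) + V n t r (U r s x) := fun n => by
          rw [← map_add, sub_add_cancel]
        simp_rw [e]
        rw [mul_apply_eq_comp, ← zero_add (U t r (U r s x))]
        refine Tendsto.add (squeeze_zero_norm (fun n => ((hV n).norm_apply t r _).le) ?_)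
          (hU t r _)
        simpa using ((hU r s x).sub_const (U r s x)).norm
      · simp only [(hV _).apply_apply]
        exact hU t s x
    · ext x
      refine ext_inner_left ℂ fun y => ?_
      rw [ContinuousLinearMap.star_eq_adjoint, ContinuousLinearMap.adjoint_inner_right]
      refine tendsto_nhds_unique (f := fun n => ⟪V n t s y, x⟫_ℂ)
        (l := atTop) ((hU t s y).inner tendsto_const_nhds) ?_
      simp only [(hV _).inner_apply_left]
      exact tendsto_const_nhds.inner (hU s t x)
  refine ⟨U, hev, ?_, fun j hj => ?_, fun z w t s => ?_⟩
  -- On the range of A^{m+1} convergence is locally uniform in (t,s); isometry extends continuity to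
  -- all vectors by uniform approximation.
  · have hw : ∀ y, Continuous fun p : ℝ × ℝ => U p.1 p.2 ((H.inv ^ (m + 1)) y) := by
      intro y
      have hbd : ∀ n (p : ℝ × ℝ),
          ‖V n p.1 p.2 ((H.inv ^ (m + 1)) y) - U p.1 p.2 ((H.inv ^ (m + 1)) y)‖ ≤
          (K' * ε n) * ((Real.exp (C * |p.1 - p.2|) * ‖y‖) * |p.1 - p.2|) := by
        intro n p
        refine le_of_tendsto_of_tendsto (tendsto_const_nhds.sub (hU p.1 p.2 _)).norm ?_
          (Eventually.of_forall fun q => hcauchy n q p.1 p.2 y)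
        have := (((hε0.const_add (ε n : ℝ)).const_mul K').mul_const
          (Real.exp (C * |p.1 - p.2|) * ‖y‖)).mul_const |p.1 - p.2|
        rwa [add_zero, mul_assoc _ _ |p.1 - p.2|] at this
      have hVc : ∀ n, Continuous fun p : ℝ × ℝ => V n p.1 p.2 ((H.inv ^ (m + 1)) y) := by
        intro n
        have hc : Continuous fun t => V n t 0 :=
          continuous_iff_continuousAt.mpr fun t => (hV' n t 0).continuousAt
        have e : (fun p : ℝ × ℝ => V n p.1 p.2 ((H.inv ^ (m + 1)) y)) = fun p : ℝ × ℝ =>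
            (V n p.1 0 * star (V n p.2 0)) ((H.inv ^ (m + 1)) y) := by
          funext p
          rw [(hV n).star_eq, (hV n).trans]
        rw [e]
        fun_prop
      refine TendstoLocallyUniformly.continuous (F := fun n (p : ℝ × ℝ) =>
        V n p.1 p.2 ((H.inv ^ (m + 1)) y)) (p := atTop) ?_ (Frequently.of_forall hVc)
      rw [Metric.tendstoLocallyUniformly_iff]
      intro δ hδ p
      set g : ℝ × ℝ → ℝ := fun p => (Real.exp (C * |p.1 - p.2|) * ‖y‖) * |p.1 - p.2| with hg
      have hgc : Continuous g := by fun_prop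
      refine ⟨_, hgc.continuousAt.eventually_lt_const (lt_add_one (g p)), ?_⟩
      have h8 : Tendsto (fun n => (K' * ε n) * (g p + 1)) atTop (𝓝 0) := by
        simpa using (hε0.const_mul K').mul_const (g p + 1)
      filter_upwards [h8.eventually_lt_const hδ] with n hn q hq
      rw [dist_comm, dist_eq_norm]
      refine ((hbd n q).trans ?_).trans_lt hn
      gcongr
    intro x
    refine continuous_of_uniform_approx_of_continuous fun u hu => ?_
    obtain ⟨δ, hδ, hδu⟩ := Metric.mem_uniformity_dist.mp hu
    obtain ⟨_, ⟨y, rfl⟩, hy⟩ := Metric.mem_closure_iff.mp (hdense x) δ hδ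
    refine ⟨_, hw y, fun p => hδu ?_⟩
    rwa [dist_eq_norm, ← map_sub, hev.norm_apply, ← dist_eq_norm]
  · obtain ⟨C, hC0, hC⟩ := h.exists_norm_sum_le hj
    refine ⟨C, hC0, fun t s x => ?_⟩
    exact le_of_tendsto (((H.inv ^ j).continuous.tendsto _).comp (hU t s x)).norm
      (Eventually.of_forall fun n => hVbd n j hj C hC t s x)
  · have hcont : ∀ n, Continuous fun r =>
        -Complex.I * ⟪H.mollify m (ε n) (ℓ r) ((H.inv ^ m) z), V n r s w⟫_ℂ := by
      intro n
      have h1 : Continuous fun r => V n r s :=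
        continuous_iff_continuousAt.mpr fun t => (hV' n t s).continuousAt
      have h2 := h.continuous
      unfold mollify
      fun_prop
    have hn : ∀ n, ⟪(H.inv ^ m) z, V n t s w⟫_ℂ - ⟪(H.inv ^ m) z, w⟫_ℂ =
        ∫ r in s..t, -Complex.I * ⟪H.mollify m (ε n) (ℓ r) ((H.inv ^ m) z), V n r s w⟫_ℂ := by
      intro n
      have hd : ∀ r, HasDerivAt (fun r => ⟪(H.inv ^ m) z, V n r s w⟫_ℂ)
          (-Complex.I * ⟪H.mollify m (ε n) (ℓ r) ((H.inv ^ m) z), V n r s w⟫_ℂ) r := fun r => by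
        have h1 := (hasDerivAt_const r ((H.inv ^ m) z)).inner ℂ
          (HasDerivAt.clm_apply_vec (hV' n r s) w)
        rw [inner_zero_left, add_zero, smul_apply, inner_smul_right, mul_apply_eq_comp,
          ← ((h.symm r).isSelfAdjoint_mollify (ε n)).inner_apply_left] at h1
        exact h1
      have h2 := intervalIntegral.integral_eq_sub_of_hasDerivAt (fun r _ => hd r)
        ((hcont n).intervalIntegrable s t)
      rw [h2, (hV n).refl_apply]
    refine tendsto_nhds_unique ((tendsto_const_nhds.inner (hU t s w)).sub_const _) ?_
    simp_rw [hn]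
    refine intervalIntegral.tendsto_integral_filter_of_dominated_convergence
      (fun _ => K * ‖z‖ * ‖w‖) (Eventually.of_forall fun n => (hcont n).aestronglyMeasurable)
      (Eventually.of_forall fun n => Eventually.of_forall fun r _ => ?_)
      intervalIntegrable_const (Eventually.of_forall fun r _ => ?_)
    · rw [norm_mul, norm_neg, Complex.norm_I, one_mul]
      refine (norm_inner_le_norm _ _).trans ?_
      rw [(hV n).norm_apply, ← mul_apply_eq_comp]
      gcongr
      exact ContinuousLinearMap.le_of_opNorm_le _
        ((H.norm_mollify_mul_inv_pow_le (hε n) m (ℓ r)).trans (hK r)) z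
    · exact ((H.tendsto_mollify m (ℓ r) z).inner (hU r s w)).const_mul _

end CommutatorFamily

end PositiveSelfAdjoint

/-! ### Regularity of the evolution and the strong equation -/

namespace PositiveSelfAdjoint

variable {E : Type*} [NormedAddCommGroup E] [InnerProductSpace ℂ E] [CompleteSpace E]
  {H : PositiveSelfAdjoint E} {U : ℝ → ℝ → E →L[ℂ] E}

/-- A unitary evolution which is controlled in the norm of `H^{-2j}` is bounded and strongly
continuous on `H^{2r}`, `r < j`; here `T` is the evolution conjugated with `A^r`, `A = H⁻¹`. -/
theorem _root_.IsUnitaryEvolution.exists_conj_negPow (hU : IsUnitaryEvolution U)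
    (hc : ∀ x, Continuous fun p : ℝ × ℝ => U p.1 p.2 x) {j : ℝ≥0} {C : ℝ} (hC0 : 0 ≤ C)
    (hC : ∀ t s x, ‖H.negPow j (U t s x)‖ ≤ Real.exp (C * |t - s|) * ‖H.negPow j x‖)
    {r : ℝ≥0} (hr : r < j) :
    ∃ T : ℝ → ℝ → E →L[ℂ] E, (∀ t s, U t s * H.negPow r = H.negPow r * T t s) ∧
      (∀ t s, ‖T t s‖ ≤ Real.exp (C * |t - s|)) ∧
      ∀ x, Continuous fun p : ℝ × ℝ => T p.1 p.2 x := by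
  have hT : ∀ q ≤ j, ∀ t s, ∃ T : E →L[ℂ] E, ‖T‖ ≤ Real.exp (C * |t - s|) ∧
      U t s * H.negPow q = H.negPow q * T := by
    intro q hq t s
    obtain ⟨T, hT1, hT2⟩ := (H.isSelfAdjoint_negPow q).exists_star_mul_eq_mul
      (H.negPow_injective q) (Real.exp_pos _).le
      (H.norm_negPow_le_of_norm_negPow_le (hU.mem_unitary s t)
        (Real.one_le_exp (by positivity)) hq (hC s t))
    rw [hU.star_eq] at hT2
    exact ⟨T, by rwa [abs_sub_comm], hT2⟩
  choose T hTn hTU using hT r hr.le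
  choose S hSn hSU using hT j le_rfl
  refine ⟨T, hTU, hTn, ?_⟩
  -- The gap j − r is where continuity comes from: on vectors A^{j−r}y, T equals A^{j−r}S with S
  -- locally bounded, and A^j S y = U A^j y is continuous, so interpolation applies to the
  -- differences of S y.
  have hδ : 0 < j - r := tsub_pos_of_lt hr
  have hjr : H.negPow j = H.negPow r * H.negPow (j - r) := by
    rw [← negPow_add, add_tsub_cancel_of_le hr.le]
  have hTS : ∀ t s y, T t s (H.negPow (j - r) y) = H.negPow (j - r) (S t s y) := by
    intro t s y
    refine H.negPow_injective r ?_
    have h1 := DFunLike.congr_fun (hTU t s) (H.negPow (j - r) y)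
    have h2 := DFunLike.congr_fun (hSU t s) y
    rw [hjr] at h2
    simp only [mul_apply_eq_comp] at h1 h2
    rw [← h1, h2]
  have hloc : ∀ p : ℝ × ℝ, ∀ᶠ q : ℝ × ℝ in 𝓝 p,
      Real.exp (C * |q.1 - q.2|) < Real.exp (C * |p.1 - p.2|) + 1 := fun p => by
    have : Continuous fun q : ℝ × ℝ => Real.exp (C * |q.1 - q.2|) := by fun_prop
    exact this.continuousAt.eventually_lt_const (lt_add_one _)
  have hdense : ∀ y, Continuous fun p : ℝ × ℝ => T p.1 p.2 (H.negPow (j - r) y) := by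
    intro y
    refine continuous_iff_continuousAt.mpr fun p => ?_
    have h0 : Tendsto (fun q : ℝ × ℝ => H.negPow (j - r) (S q.1 q.2 y - S p.1 p.2 y)) (𝓝 p)
        (𝓝 0) := by
      refine H.tendsto_negPow_zero (M := (Real.exp (C * |p.1 - p.2|) + 1) * ‖y‖ +
        ‖S p.1 p.2 y‖) (j := j) ?_ ?_ hδ
      · filter_upwards [hloc p] with q hq
        refine (norm_sub_le _ _).trans (add_le_add_left ?_ _)
        exact (S q.1 q.2).le_of_opNorm_le ((hSn _ _).trans hq.le) y
      · have e : ∀ q : ℝ × ℝ, H.negPow j (S q.1 q.2 y - S p.1 p.2 y) =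
            U q.1 q.2 (H.negPow j y) - U p.1 p.2 (H.negPow j y) := fun q => by
          rw [map_sub, ← mul_apply_eq_comp, ← mul_apply_eq_comp, ← hSU, ← hSU]; rfl
        simp_rw [e]
        simpa using ((hc (H.negPow j y)).continuousAt (x := p)).tendsto.sub_const
          (U p.1 p.2 (H.negPow j y))
    have h1 := h0.add_const (H.negPow (j - r) (S p.1 p.2 y))
    simp only [map_sub, sub_add_cancel, zero_add, ← hTS] at h1
    exact h1
  intro x
  refine continuous_iff_continuousAt.mpr fun p =>
    continuousAt_of_locally_uniform_approx_of_continuousAt fun u hu => ?_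
  obtain ⟨δ, hδ', hδu⟩ := Metric.mem_uniformity_dist.mp hu
  set D := Real.exp (C * |p.1 - p.2|) + 1
  have hD : 0 < D := by positivity
  obtain ⟨_, ⟨y, rfl⟩, hy⟩ := Metric.mem_closure_iff.mp (H.denseRange_negPow (j - r) x) (δ / D)
    (by positivity)
  refine ⟨_, hloc p, _, (hdense y).continuousAt, fun q hq => hδu ?_⟩
  rw [dist_eq_norm] at hy ⊢
  rw [← map_sub]
  calc _ ≤ D * ‖x - H.negPow (j - r) y‖ :=
        (T q.1 q.2).le_of_opNorm_le ((hTn _ _).trans (le_of_lt hq)) _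
    _ < D * (δ / D) := by gcongr
    _ = δ := by field_simp

variable {m : ℕ} {ℓ : ℝ → E →L[ℂ] E}

/-- The weak form of the equation `i ψ' = L(t) ψ` for `ψ(t) = U(t,s) w` implies its strong form
in `H^{2r}`, as soon as `ψ` is a continuous function with values in `H^{2(r+m)}`. -/
theorem hasDerivAt_of_weak_equation {s : ℝ} {w : E}
    (hsymm : ∀ t, IsSelfAdjoint (H.inv ^ m * ℓ t))
    (hweak : ∀ z t, ⟪(H.inv ^ m) z, U t s w⟫_ℂ - ⟪(H.inv ^ m) z, w⟫_ℂ =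
        ∫ r in s..t, -Complex.I * ⟪ℓ r z, U r s w⟫_ℂ) (hUs : U s s w = w)
    {r : ℝ≥0} {ℓr : ℝ → E →L[ℂ] E} (hℓr : Continuous ℓr)
    (hcomm : ∀ t x, H.negPow r (ℓr t x) = ℓ t (H.negPow r x)) {x y : ℝ → E} (hy : Continuous y)
    (hxy : ∀ t, x t = (H.inv ^ m) (y t)) (hx : ∀ t, H.negPow r (x t) = U t s w) (t : ℝ) :
    HasDerivAt x ((-Complex.I) • ℓr t (y t)) t := by
  have hcont : Continuous fun t => (-Complex.I) • ℓr t (y t) := by fun_prop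
  have hX : x = fun t => x s + ∫ τ in s..t, (-Complex.I) • ℓr τ (y τ) := by
    funext t
    -- The integral equation in H^{2r} is checked after applying the injective operators A^r and A^m
    -- and pairing with z, which is the weak equation.
    refine H.negPow_injective r (H.inv_pow_injective m (ext_inner_left ℂ fun z => ?_))
    have hsa := H.isSelfAdjoint_inv_pow m
    rw [← hsa.inner_apply_left, ← hsa.inner_apply_left, map_add, inner_add_right, hx, hx, hUs,
      ← sub_eq_iff_eq_add', hweak]
    have e : ∀ τ, -Complex.I * ⟪ℓ τ z, U τ s w⟫_ℂ =
        ((innerSL ℂ ((H.inv ^ m) z)).comp (H.negPow r)) ((-Complex.I) • ℓr τ (y τ)) := by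
      intro τ
      have hA : H.negPow r ((H.inv ^ m) (y τ)) = (H.inv ^ m) (H.negPow r (y τ)) := by
        rw [← negPow_natCast]
        exact DFunLike.congr_fun (H.negPow_comm r m) (y τ)
      rw [← hx, hxy, map_smul, smul_eq_mul, hA]
      congr 1
      rw [ContinuousLinearMap.comp_apply, innerSL_apply_apply, hcomm, ← hsa.inner_apply_left,
        hsa.inner_apply_left z]
      exact (hsymm τ).inner_apply_left z _
    simp_rw [e]
    rw [ContinuousLinearMap.intervalIntegral_comp_comm _ (hcont.intervalIntegrable s t)]
    rfl
  rw [hX]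
  exact (intervalIntegral.integral_hasDerivAt_right (hcont.intervalIntegrable s t)
    (hcont.stronglyMeasurableAtFilter _ _) hcont.continuousAt).const_add _

/-- Uniqueness for `i x' = L(t) x`, where `x = A^m y` and `L(t) x = ℓ(t) y`. -/
theorem eq_zero_of_hasDerivAt (hsymm : ∀ t, IsSelfAdjoint (H.inv ^ m * ℓ t)) {x y : ℝ → E}
    (hxy : ∀ t, x t = (H.inv ^ m) (y t))
    (hx : ∀ t, HasDerivAt x ((-Complex.I) • ℓ t (y t)) t) {s : ℝ} (hs : x s = 0) : x = 0 := by
  funext t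
  -- With P = 1 and C = 0 the energy estimate is conservation of the norm, as ⟨x, L x⟩ is real.
  have h := norm_le_exp_mul_norm_of_abs_im_inner_le (P := (1 : E →L[ℂ] E)) (C := 0) hx
    (fun t => by
      have h1 : (⟪x t, ℓ t (y t)⟫_ℂ).im = 0 := by
        rw [hxy, (H.isSelfAdjoint_inv_pow m).inner_apply_left, ← Complex.conj_eq_iff_im,
          inner_conj_symm]
        exact (hsymm t).inner_apply_left _ _
      simp [h1]) t s
  rw [hs, map_zero, norm_zero, mul_zero] at h
  exact norm_le_zero_iff.mp h

end PositiveSelfAdjoint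

/-! ### Translating the hypotheses to bounded operators -/

namespace PositiveSelfAdjoint

variable {E : Type*} [NormedAddCommGroup E] [InnerProductSpace ℂ E] [CompleteSpace E]
  {H : PositiveSelfAdjoint E}

variable (H) in
/-- `H^{k/2}` as an isometry of `H^k` onto `E`. -/
def Scale.isometry (k : ℝ≥0) : H.Scale k ≃ₗᵢ[ℂ] E where
  __ := Scale.halfPow H k
  norm_map' u := (Scale.norm_def u).symm

theorem Scale.negPow_isometry {k : ℝ≥0} (u : H.Scale k) :
    H.negPow (k / 2) (Scale.isometry H k u) = (u : E) :=
  Scale.negPow_halfPow u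

theorem Scale.coe_isometry_symm {k : ℝ≥0} (x : E) :
    ((Scale.isometry H k).symm x : E) = H.negPow (k / 2) x := by
  rw [← Scale.negPow_isometry, LinearIsometryEquiv.apply_symm_apply]

theorem Scale.coe_injective {k : ℝ≥0} {u v : H.Scale k} (h : (u : E) = v) : u = v :=
  Subtype.ext h

theorem mem_domainPow_iff {k : ℝ≥0} {x : E} :
    x ∈ H.domainPow k ↔ ∃ y, H.negPow (k / 2) y = x := LinearMap.mem_range

/-- The bounded family `F(t) : H^a → H^b`, conjugated to a family of operators on `E`. -/
theorem exists_conj_isometry {a b : ℝ≥0} (F : ℝ →ᵇ (H.Scale a →L[ℂ] H.Scale b)) :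
    ∃ G : ℝ → E →L[ℂ] E, Continuous G ∧ (∃ K, ∀ t, ‖G t‖ ≤ K) ∧
      ∀ t x, (F t ((Scale.isometry H a).symm x) : E) = H.negPow (b / 2) (G t x) := by
  let Ib : H.Scale b →L[ℂ] E := (Scale.isometry H b).toContinuousLinearEquiv
  let Ia : E →L[ℂ] H.Scale a := (Scale.isometry H a).symm.toContinuousLinearEquiv
  refine ⟨fun t => Ib.comp ((F t).comp Ia), ?_, ⟨‖Ib‖ * (‖F‖ * ‖Ia‖), fun t => ?_⟩, fun t x => ?_⟩
  · have := F.continuous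
    fun_prop
  · refine (Ib.opNorm_comp_le _).trans ?_
    gcongr
    refine ((F t).opNorm_comp_le _).trans ?_
    gcongr
    exact F.norm_coe_le_norm t
  · exact (Scale.negPow_isometry _).symm

/-- Two continuous functions which agree on the range of the cutoffs are equal. -/
theorem eq_of_eq_cutoff {F : Type*} [TopologicalSpace F] [T2Space F] {f g : E → F}
    (H : PositiveSelfAdjoint E) (hf : Continuous f) (hg : Continuous g)
    (h : ∀ ε : ℝ≥0, 0 < ε → ∀ y, f (H.cutoff ε 0 y) = g (H.cutoff ε 0 y)) : f = g := by
  funext y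
  refine tendsto_nhds_unique ((hf.tendsto y).comp (H.tendsto_cutoff y)) ?_
  refine ((hg.tendsto y).comp (H.tendsto_cutoff y)).congr fun n => ?_
  exact (h _ (by positivity) y).symm

theorem negPow_cutoff_mem (H : PositiveSelfAdjoint E) {ε : ℝ≥0} (hε : 0 < ε) (r : ℝ≥0) (y : E)
    (k : ℝ≥0) : H.negPow r (H.cutoff ε 0 y) ∈ H.domainPow k := by
  rw [← mul_apply_eq_comp, ← cutoff_mul_negPow]
  exact H.cutoff_mem_domainPow hε _ _

theorem commutatorInvEq_unique {T : E →ₗ.[ℂ] E} {χ w w' : E} (h : H.CommutatorInvEq T χ w)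
    (h' : H.CommutatorInvEq T χ w') : w = w' := by
  obtain ⟨_, _, _, rfl⟩ := h
  obtain ⟨_, _, _, rfl⟩ := h'
  rfl

variable {L : ℝ → E →ₗ.[ℂ] E} {m k₀ : ℕ} {k₁ : ℝ≥0}

/-- Formally ℓ(t) = A^{−k/2} L(t) A^{k/2+m}; the isometries of the scale with `E` make it bounded
and norm continuous. The case k = 0 is L(t)A^m. -/
theorem BoundedContinuousFamily.exists_conj (h0 : H.BoundedContinuousFamily L m k₀) {k : ℝ≥0}
    (hk : k ≤ k₀) : ∃ ℓ : ℝ → E →L[ℂ] E, Continuous ℓ ∧ (∃ K, ∀ t, ‖ℓ t‖ ≤ K) ∧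
      ∀ t x, ∃ h : H.negPow (k / 2 + m) x ∈ (L t).domain,
        L t ⟨_, h⟩ = H.negPow (k / 2) (ℓ t x) := by
  obtain ⟨F, hF⟩ := h0 k hk
  obtain ⟨G, hGc, hGK, hG⟩ := exists_conj_isometry F
  refine ⟨G, hGc, hGK, fun t x => ?_⟩
  have e : ((Scale.isometry H (k + 2 * m)).symm x : E) = H.negPow (k / 2 + m) x := by
    rw [Scale.coe_isometry_symm, add_div, mul_div_cancel_left₀ _ two_ne_zero]
  obtain ⟨h, hL⟩ := hF t ((Scale.isometry H (k + 2 * m)).symm x)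
  rw [hG] at hL
  simp only [e] at h hL
  exact ⟨h, hL⟩

theorem BoundedContinuousCommutator.exists_conj (h2 : H.BoundedContinuousCommutator L k₁) {l : ℕ}
    (hl : (l : ℝ≥0) ≤ k₁) : ∃ B : ℝ → E →L[ℂ] E, (∃ b, ∀ t, ‖B t‖ ≤ b) ∧
      ∀ t x, (∀ j, (H.inv ^ l) x ∈ H.domainPow j) →
        H.CommutatorInvEq (L t) ((H.inv ^ l) x) ((H.inv ^ l) (B t x)) := by
  obtain ⟨F, hF⟩ := h2 (2 * l) (by gcongr)
  obtain ⟨G, -, hGK, hG⟩ := exists_conj_isometry F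
  refine ⟨G, hGK, fun t x hx => ?_⟩
  have e : ((Scale.isometry H (2 * l)).symm x : E) = (H.inv ^ l) x := by
    rw [Scale.coe_isometry_symm, mul_div_cancel_left₀ _ two_ne_zero, negPow_natCast]
  have h := hF t ((Scale.isometry H (2 * l)).symm x)
  rw [hG, e, mul_div_cancel_left₀ _ two_ne_zero, negPow_natCast] at h
  exact h hx

/-- The conjugated family `L(t) A^m` and the conjugated commutators satisfy the assumptions of the
bounded theory. -/
theorem exists_commutatorFamily (hk₁ : 2 * (m : ℝ≥0) < k₁)
    (h0 : H.BoundedContinuousFamily L m k₀) (h1 : ∀ t, H.SymmetricOn (L t) (k₀ + 2 * m))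
    (h2 : H.BoundedContinuousCommutator L k₁) :
    ∃ ℓ B, CommutatorFamily H m ⌊k₁⌋₊ ℓ B ∧
      ∀ t x, ∃ h : (H.inv ^ m) x ∈ (L t).domain, L t ⟨_, h⟩ = ℓ t x := by
  obtain ⟨ℓ, hℓc, hℓK, hℓ⟩ := h0.exists_conj (k := 0) zero_le
  simp only [zero_div, zero_add, negPow_zero, negPow_natCast, one_apply_eq_self] at hℓ
  have hB : ∀ l : ℕ, ∃ B : ℝ → E →L[ℂ] E, l ≤ ⌊k₁⌋₊ → (∃ b, ∀ t, ‖B t‖ ≤ b) ∧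
      ∀ t x, (∀ j, (H.inv ^ l) x ∈ H.domainPow j) →
        H.CommutatorInvEq (L t) ((H.inv ^ l) x) ((H.inv ^ l) (B t x)) := fun l => by
    by_cases hl : l ≤ ⌊k₁⌋₊
    · obtain ⟨B, hB⟩ := h2.exists_conj ((Nat.le_floor_iff zero_le).mp hl)
      exact ⟨B, fun _ => hB⟩
    · exact ⟨0, fun h => absurd h hl⟩
  choose B hB using hB
  have hmem : ∀ (l : ℕ) {ε : ℝ≥0}, 0 < ε → ∀ y j, (H.inv ^ l) (H.cutoff ε 0 y) ∈ H.domainPow j := by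
    intro l ε hε y j
    rw [← negPow_natCast]
    exact H.negPow_cutoff_mem hε _ _ _
  refine ⟨ℓ, B, ⟨?_, hℓc, hℓK, fun l hl => (hB l hl).1, fun t => ⟨?_, fun l hl => ?_, ?_⟩⟩, hℓ⟩
  · refine Nat.le_floor (le_trans ?_ hk₁.le)
    exact le_mul_of_one_le_left zero_le one_le_two
  · have hinner : ∀ x y, ⟪ℓ t x, (H.inv ^ m) y⟫_ℂ = ⟪(H.inv ^ m) x, ℓ t y⟫_ℂ := by
      intro x y
      refine congrFun (H.eq_of_eq_cutoff (f := fun x => ⟪ℓ t x, (H.inv ^ m) y⟫_ℂ)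
        (g := fun x => ⟪(H.inv ^ m) x, ℓ t y⟫_ℂ) (by fun_prop) (by fun_prop) fun ε hε x => ?_) x
      refine congrFun (H.eq_of_eq_cutoff
        (f := fun y => ⟪ℓ t (H.cutoff ε 0 x), (H.inv ^ m) y⟫_ℂ)
        (g := fun y => ⟪(H.inv ^ m) (H.cutoff ε 0 x), ℓ t y⟫_ℂ)
        (by fun_prop) (by fun_prop) fun ε' hε' y => ?_) y
      obtain ⟨hx, hx'⟩ := hℓ t (H.cutoff ε 0 x)
      obtain ⟨hy, hy'⟩ := hℓ t (H.cutoff ε' 0 y)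
      have := h1 t ⟨_, hx⟩ ⟨_, hy⟩ (hmem m hε x _) (hmem m hε' y _)
      rwa [hx', hy'] at this
    rw [ContinuousLinearMap.isSelfAdjoint_iff_isSymmetric]
    intro x y
    change ⟪(H.inv ^ m) (ℓ t x), y⟫_ℂ = ⟪x, (H.inv ^ m) (ℓ t y)⟫_ℂ
    rw [(H.isSelfAdjoint_inv_pow m).inner_apply_left, hinner,
      (H.isSelfAdjoint_inv_pow m).inner_apply_left]
  · refine DFunLike.coe_injective (H.eq_of_eq_cutoff (ContinuousLinearMap.continuous _)
      (ContinuousLinearMap.continuous _) fun ε hε y => ?_)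
    -- B₀A^l and A^l B_l both compute the commutator at the same vector of H^∞, where its value is
    -- unique; cutoff vectors are dense, which gives equality everywhere.
    have e0 := (hB 0 (Nat.zero_le _)).2 t ((H.inv ^ l) (H.cutoff ε 0 y)) (fun j => by
      simpa using hmem l hε y j)
    have el := (hB l hl).2 t (H.cutoff ε 0 y) (hmem l hε y)
    simp only [pow_zero, one_apply_eq_self] at e0
    exact commutatorInvEq_unique e0 el
  · refine DFunLike.coe_injective (H.eq_of_eq_cutoff (ContinuousLinearMap.continuous _)
      (ContinuousLinearMap.continuous _) fun ε hε y => ?_)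
    have e0 := (hB 0 (Nat.zero_le _)).2 t ((H.inv ^ m) (H.cutoff ε 0 y)) (fun j => by
      simpa using hmem m hε y j)
    simp only [pow_zero, one_apply_eq_self] at e0
    set x := H.cutoff ε 0 y
    obtain ⟨g₁, g₂, g₃, g⟩ := e0
    obtain ⟨f₁, f₁'⟩ := hℓ t x
    obtain ⟨f₂, f₂'⟩ := hℓ t (H.inv x)
    have hinv : H.inv ((H.inv ^ m) x) = (H.inv ^ m) (H.inv x) := by
      rw [← mul_apply_eq_comp, ← pow_succ', pow_succ]; rfl
    have hL : L t ⟨_, g₂⟩ = ℓ t (H.inv x) := by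
      rw [← f₂']; congr 1; exact Subtype.ext hinv
    rw [f₁'] at g
    -- Applying A to H L A χ = Lχ − B₀χ at χ = A^m x removes the unbounded operator and leaves the
    -- commutator relation.
    have g' : H.op ⟨_, g₃⟩ = ℓ t x - B 0 t ((H.inv ^ m) x) := by rw [← g]; abel
    have g'' := (H.inv_op ⟨_, g₃⟩).trans hL
    rw [g', map_sub] at g''
    simp only [sub_apply, mul_apply_eq_comp]
    rw [← g'']; abel

end PositiveSelfAdjoint

/-! ### Propagators on the scale -/

namespace PositiveSelfAdjoint

variable {E : Type*} [NormedAddCommGroup E] [InnerProductSpace ℂ E] [CompleteSpace E]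
  {H : PositiveSelfAdjoint E} {L : ℝ → E →ₗ.[ℂ] E} {m k₀ : ℕ} {ℓ : ℝ → E →L[ℂ] E}

theorem hasDerivAt_scale_symm {k : ℝ≥0} {x : ℝ → E} {x' : E} {t : ℝ} (hx : HasDerivAt x x' t) :
    HasDerivAt (fun t => (Scale.isometry H k).symm (x t)) ((Scale.isometry H k).symm x') t := by
  let I : E →L[ℂ] H.Scale k := (Scale.isometry H k).symm.toContinuousLinearEquiv
  exact (I.restrictScalars ℝ).hasFDerivAt.comp_hasDerivAt t hx

theorem hasDerivAt_scale_coe {k : ℝ≥0} {u : ℝ → H.Scale k} {u' : H.Scale k} {t : ℝ}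
    (hu : HasDerivAt u u' t) : HasDerivAt (fun t => (u t : E)) (u' : E) t := by
  let I : H.Scale k →L[ℂ] E := (Scale.isometry H k).toContinuousLinearEquiv
  have h := (((H.negPow (k / 2)).comp I).restrictScalars ℝ).hasFDerivAt.comp_hasDerivAt t hu
  have e : ∀ v, ((H.negPow (k / 2)).comp I).restrictScalars ℝ v = (v : E) :=
    fun v => Scale.negPow_isometry v
  simp only [Function.comp_def, e] at h
  exact h

theorem negPow_half_add (H : PositiveSelfAdjoint E) (k : ℝ≥0) (m : ℕ) (x : E) :
    H.negPow ((k + 2 * m) / 2) x = (H.inv ^ m) (H.negPow (k / 2) x) := by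
  rw [add_div, mul_div_cancel_left₀ _ two_ne_zero, add_comm, negPow_add, negPow_natCast]; rfl

/-- Any solution, viewed in `E`, is differentiable with values in the range of A^m, so uniqueness
reduces to norm conservation in `E` whatever k is. -/
theorem IsSolution.unique {k : ℝ≥0} {s : ℝ} {w : E} {ψ φ : ℝ → E}
    (hsymm : ∀ t, IsSelfAdjoint (H.inv ^ m * ℓ t))
    (hℓ : ∀ t x, ∃ h : (H.inv ^ m) x ∈ (L t).domain, L t ⟨_, h⟩ = ℓ t x)
    (hψ : H.IsSolution L m k s w ψ) (hφ : H.IsSolution L m k s w φ) : ψ = φ := by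
  have key : ∀ {ψ}, H.IsSolution L m k s w ψ → ∃ y : ℝ → E, (∀ t, ψ t = (H.inv ^ m) (y t)) ∧
      ∀ t, HasDerivAt ψ ((-Complex.I) • ℓ t (y t)) t := by
    intro ψ hψ
    obtain ⟨v, -, hv⟩ := hψ.continuous
    obtain ⟨u, hu, huψ, heq⟩ := hψ.equation
    refine ⟨fun t => H.negPow (k / 2) (Scale.isometry H _ (v t)), fun t => ?_, fun t => ?_⟩
    · rw [← negPow_half_add, Scale.negPow_isometry, hv]
    · set y := H.negPow (k / 2) (Scale.isometry H _ (v t)) with hy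
      have hψy : ψ t = (H.inv ^ m) y := by
        rw [hy, ← negPow_half_add, Scale.negPow_isometry, hv]
      have hd := hasDerivAt_scale_coe ((hu.differentiable one_ne_zero) t).hasDerivAt
      obtain ⟨h1, h2⟩ := heq t
      obtain ⟨h3, h4⟩ := hℓ t y
      have h5 : L t ⟨ψ t, h1⟩ = ℓ t y := by
        rw [← h4]; congr 1; exact Subtype.ext hψy
      have h6 : ((deriv u t : H.Scale k) : E) = (-Complex.I) • ℓ t y := by
        rw [← h5, ← h2, smul_smul]; simp
      rw [h6] at hd
      simpa only [huψ] using hd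
  obtain ⟨y, hy, hy'⟩ := key hψ
  obtain ⟨z, hz, hz'⟩ := key hφ
  have h := H.eq_zero_of_hasDerivAt hsymm (x := ψ - φ) (y := y - z) (s := s)
    (fun t => by simp [hy, hz]) (fun t => by
      have := (hy' t).sub (hz' t)
      simpa [smul_sub] using this) (by simp [hψ.initial, hφ.initial])
  exact sub_eq_zero.mp h

/-- The restriction to `H^k` of the unitary evolution of a family of operators is a propagator. -/
theorem exists_isPropagator (h0 : H.BoundedContinuousFamily L m k₀) {N : ℕ}
    {B : ℕ → ℝ → E →L[ℂ] E} (hfam : CommutatorFamily H m N ℓ B)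
    (hℓ : ∀ t x, ∃ h : (H.inv ^ m) x ∈ (L t).domain, L t ⟨_, h⟩ = ℓ t x)
    {U : ℝ → ℝ → E →L[ℂ] E} (hU : IsUnitaryEvolution U)
    (hc : ∀ x, Continuous fun p : ℝ × ℝ => U p.1 p.2 x)
    (hbd : ∀ j ≤ N + 1, ∃ C, 0 ≤ C ∧ ∀ t s x,
        ‖(H.inv ^ j) (U t s x)‖ ≤ Real.exp (C * |t - s|) * ‖(H.inv ^ j) x‖)
    (hweak : ∀ z w t s, ⟪(H.inv ^ m) z, U t s w⟫_ℂ - ⟪(H.inv ^ m) z, w⟫_ℂ =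
        ∫ r in s..t, -Complex.I * ⟪ℓ r z, U r s w⟫_ℂ)
    {k : ℝ≥0} (hk₀ : k ≤ k₀) (hkN : ⌊k / 2 + m⌋₊ ≤ N) :
    ∃ V : ℝ → ℝ → H.Scale k →L[ℂ] H.Scale k, H.IsPropagator L m k V ∧
      (∀ t s (w : H.Scale k), (V t s w : E) = U t s w) ∧
      ∃ C, 0 ≤ C ∧ ∀ t s, ‖V t s‖ ≤ Real.exp (C * |t - s|) := by
  -- The smallest integer strictly above k/2 + m, as strong continuity in both H^k and H^{k+2m}
  -- requires; it is still at most N + 1.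
  obtain ⟨C, hC0, hC⟩ := hbd (⌊k / 2 + m⌋₊ + 1) (by omega)
  simp only [← negPow_natCast] at hC
  have hlt : k / 2 + m < ((⌊k / 2 + m⌋₊ + 1 : ℕ) : ℝ≥0) := by
    push_cast; exact Nat.lt_floor_add_one _
  obtain ⟨T, hTU, hTn, hTc⟩ := hU.exists_conj_negPow hc hC0 hC
    (lt_of_le_of_lt le_self_add hlt : k / 2 < _)
  obtain ⟨S, hSU, -, hSc⟩ := hU.exists_conj_negPow hc hC0 hC hlt
  obtain ⟨ℓk, hℓkc, -, hℓk⟩ := h0.exists_conj hk₀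
  have hcomm : ∀ t x, H.negPow (k / 2) (ℓk t x) = ℓ t (H.negPow (k / 2) x) := by
    intro t x
    obtain ⟨h1, h2⟩ := hℓk t x
    obtain ⟨h3, h4⟩ := hℓ t (H.negPow (k / 2) x)
    rw [← h2, ← h4]
    congr 1
    refine Subtype.ext ?_
    change H.negPow (k / 2 + m) x = _
    rw [add_comm, negPow_add, negPow_natCast]; rfl
  let I : H.Scale k →L[ℂ] E := (Scale.isometry H k).toContinuousLinearEquiv
  let I' : E →L[ℂ] H.Scale k := (Scale.isometry H k).symm.toContinuousLinearEquiv
  let V : ℝ → ℝ → H.Scale k →L[ℂ] H.Scale k := fun t s => I'.comp ((T t s).comp I)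
  have hV : ∀ t s w, V t s w = (Scale.isometry H k).symm (T t s (Scale.isometry H k w)) :=
    fun _ _ _ => rfl
  have hVU : ∀ t s (w : H.Scale k), (V t s w : E) = U t s w := by
    intro t s w
    rw [hV, Scale.coe_isometry_symm, ← mul_apply_eq_comp, ← hTU, mul_apply_eq_comp,
      Scale.negPow_isometry]
  have hsol : ∀ (s : ℝ) (w : H.Scale k), (w : E) ∈ H.domainPow (k + 2 * m) →
      H.IsSolution L m k s w fun t => (V t s w : E) := by
    intro s w hw
    obtain ⟨y₀, hy₀⟩ := mem_domainPow_iff.mp hw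
    have hadd : (k + 2 * m) / 2 = k / 2 + (m : ℝ≥0) := by
      rw [add_div, mul_div_cancel_left₀ _ two_ne_zero]
    rw [hadd] at hy₀
    set y : ℝ → E := fun t => S t s y₀ with hy
    have hyc : Continuous y := (hSc y₀).comp (by fun_prop : Continuous fun t : ℝ => (t, s))
    have hyU : ∀ t, H.negPow (k / 2 + m) (y t) = U t s w := fun t => by
      rw [← hy₀, ← mul_apply_eq_comp, ← mul_apply_eq_comp, hSU]
    have hψ : ∀ t, H.negPow (k / 2) ((H.inv ^ m) (y t)) = U t s w := fun t => by
      rw [← hyU, negPow_add, negPow_natCast]; rfl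
    have hd := hasDerivAt_of_weak_equation (fun t => (hfam.symm t).symm)
      (fun z t => hweak z w t s) (hU.refl_apply s w) hℓkc hcomm hyc (fun _ => rfl) hψ
    have hdu := fun t => hasDerivAt_scale_symm (H := H) (k := k) (hd t)
    refine ⟨?_, ⟨fun t => (Scale.isometry H _).symm (y t),
      (LinearIsometryEquiv.continuous _).comp hyc, fun t => ?_⟩,
      ⟨fun t => (Scale.isometry H k).symm ((H.inv ^ m) (y t)), ?_, fun t => ?_, fun t => ?_⟩⟩
    · rw [hVU, hU.refl_apply]
    · rw [Scale.coe_isometry_symm, hadd, hyU, hVU]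
    · rw [contDiff_one_iff_deriv]
      refine ⟨fun t => (hdu t).differentiableAt, ?_⟩
      rw [funext fun t => (hdu t).deriv]
      exact (Scale.isometry H k).symm.continuous.comp (by fun_prop)
    · rw [Scale.coe_isometry_symm, hψ, hVU]
    · obtain ⟨h1, h2⟩ := hℓk t (y t)
      rw [(hdu t).deriv, Scale.coe_isometry_symm, map_smul, smul_smul]
      have e : (V t s w : E) = H.negPow (k / 2 + m) (y t) := by rw [hVU, hyU]
      simp only [e]
      refine ⟨h1, ?_⟩
      rw [h2]
      simp
  refine ⟨V, ⟨fun w => ?_, hsol, fun s w hw ψ hψ => ?_⟩, hVU, C, hC0, fun t s => ?_⟩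
  · exact (Scale.isometry H k).symm.continuous.comp (hTc _)
  · exact hψ.unique (fun t => (hfam.symm t).symm) hℓ (hsol s w hw)
  · refine ContinuousLinearMap.opNorm_le_bound _ (Real.exp_pos _).le fun w => ?_
    rw [hV, LinearIsometryEquiv.norm_map, ← (Scale.isometry H k).norm_map w]
    exact (T t s).le_of_opNorm_le (hTn t s) _

/-- Uniqueness of solutions forces agreement on H^{k+2m}, which is dense in H^k. -/
theorem IsPropagator.unique {k : ℝ≥0} {U V : ℝ → ℝ → H.Scale k →L[ℂ] H.Scale k}
    (hU : H.IsPropagator L m k U) (hV : H.IsPropagator L m k V) : V = U := by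
  funext t s
  have hmem : ∀ y, (((Scale.isometry H k).symm (H.negPow m y) : H.Scale k) : E) ∈
      H.domainPow (k + 2 * m) := fun y => by
    rw [Scale.coe_isometry_symm]
    refine mem_domainPow_iff.mpr ⟨y, ?_⟩
    rw [add_div, mul_div_cancel_left₀ _ two_ne_zero, negPow_add]; rfl
  have hd : DenseRange fun y => (Scale.isometry H k).symm (H.negPow m y) :=
    (Scale.isometry H k).symm.surjective.denseRange.comp (H.denseRange_negPow m)
      (LinearIsometryEquiv.continuous _)
  refine DFunLike.coe_injective (hd.equalizer (V t s).continuous (U t s).continuous ?_)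
  funext y
  have h := hU.unique_solution s _ (hmem y) _ (hV.isSolution s _ (hmem y))
  exact Scale.coe_injective (congrFun h t)

end PositiveSelfAdjoint

/-! ### The basic criterion for essential self-adjointness -/

section Criterion

variable {E : Type*} [NormedAddCommGroup E] [InnerProductSpace ℂ E] [CompleteSpace E]
  {T : E →ₗ.[ℂ] E}

theorem LinearPMap.inner_eq_of_mem_graph_closure {x y a b : E} (hT : T.IsClosable)
    (hd : Dense (T.domain : Set E)) (hxy : (x, y) ∈ T.closure.graph) (hab : (a, b) ∈ T†.graph) :
    ⟪b, x⟫_ℂ = ⟪a, y⟫_ℂ := by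
  have hcl : _root_.IsClosed {p : E × E | ⟪b, p.1⟫_ℂ = ⟪a, p.2⟫_ℂ} :=
    isClosed_eq (by fun_prop) (by fun_prop)
  rw [← hT.graph_closure_eq_closure_graph] at hxy
  refine closure_minimal (s := (T.graph : Set (E × E))) ?_ hcl hxy
  rintro ⟨u, v⟩ huv
  obtain ⟨u', rfl, rfl⟩ := (LinearPMap.mem_graph_iff _).mp huv
  obtain ⟨a', rfl, rfl⟩ := (LinearPMap.mem_graph_iff _).mp hab
  exact LinearPMap.adjoint_isFormalAdjoint hd a' u'

/-- The shift of a closed symmetric operator by a non-real number has closed range. -/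
theorem LinearPMap.exists_mem_graph_sub_smul_eq (hd : Dense (T.domain : Set E))
    (hsymm : T.IsFormalAdjoint T) (hT : T.IsClosable) {c : ℝ} (hc : 0 < c)
    (hrange : ∀ v, (∀ u : T.domain, ⟪T u - (c * Complex.I) • (u : E), v⟫_ℂ = 0) → v = 0) (z : E) :
    ∃ p ∈ T.closure.graph, p.2 - (c * Complex.I) • p.1 = z := by
  have hcl : _root_.IsClosed (T.closure.graph : Set (E × E)) := hT.closure_isClosed
  have : CompleteSpace T.closure.graph := hcl.completeSpace_coe
  have hle : T.closure.graph ≤ T†.graph := by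
    have h1 := LinearPMap.le_graph_of_le (hsymm.le_adjoint hd)
    rw [← hT.graph_closure_eq_closure_graph]
    exact Submodule.topologicalClosure_minimal _ h1 (LinearPMap.adjoint_isClosed hd)
  let S : T.closure.graph →L[ℂ] E := (ContinuousLinearMap.snd ℂ E E -
    (c * Complex.I : ℂ) • ContinuousLinearMap.fst ℂ E E).comp T.closure.graph.subtypeL
  have hS : ∀ p : T.closure.graph, S p = (p : E × E).2 - (c * Complex.I : ℂ) • (p : E × E).1 :=
    fun _ => rfl
  -- The cross term vanishes because ⟨y, x⟩ is real for (x, y) in the graph of the closure; this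
  -- makes the shifted operator bounded below.
  have hnorm : ∀ p : T.closure.graph,
      ‖S p‖ ^ 2 = ‖(p : E × E).2‖ ^ 2 + c ^ 2 * ‖(p : E × E).1‖ ^ 2 := by
    intro p
    have h1 : ⟪(p : E × E).2, (p : E × E).1⟫_ℂ = ⟪(p : E × E).1, (p : E × E).2⟫_ℂ :=
      LinearPMap.inner_eq_of_mem_graph_closure hT hd p.2 (hle p.2)
    have h2 : (⟪(p : E × E).2, (p : E × E).1⟫_ℂ).im = 0 := by
      rw [← Complex.conj_eq_iff_im, inner_conj_symm, h1]
    rw [hS, @norm_sub_sq ℂ, inner_smul_right, norm_smul]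
    simp [mul_pow, h2]
  have hanti : AntilipschitzWith (max 1 (c⁻¹).toNNReal) S := by
    refine AddMonoidHomClass.antilipschitz_of_bound S (fun p => ?_)
    have h1 : ‖p‖ = max ‖(p : E × E).1‖ ‖(p : E × E).2‖ := rfl
    have h2 : ‖(p : E × E).2‖ ≤ ‖S p‖ := by
      refine le_of_sq_le_sq ?_ (norm_nonneg _)
      rw [hnorm]; nlinarith [sq_nonneg (c * ‖(p : E × E).1‖)]
    have h3 : c * ‖(p : E × E).1‖ ≤ ‖S p‖ := by
      refine le_of_sq_le_sq ?_ (norm_nonneg _)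
      rw [hnorm]; nlinarith [sq_nonneg ‖(p : E × E).2‖]
    have hc' : ((c⁻¹).toNNReal : ℝ) = c⁻¹ := Real.coe_toNNReal _ (inv_nonneg.mpr hc.le)
    rw [h1, NNReal.coe_max, hc', NNReal.coe_one]
    refine max_le ?_ ?_
    · calc ‖(p : E × E).1‖ = c⁻¹ * (c * ‖(p : E × E).1‖) := by field_simp
        _ ≤ c⁻¹ * ‖S p‖ := by gcongr
        _ ≤ _ := by gcongr; exact le_max_right _ _
    · calc ‖(p : E × E).2‖ ≤ 1 * ‖S p‖ := by rwa [one_mul]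
        _ ≤ _ := by gcongr; exact le_max_left _ _
  have hrc : _root_.IsClosed (Set.range S) := hanti.isClosed_range S.uniformContinuous
  let K : Submodule ℂ E := LinearMap.range S.toLinearMap
  have hK : _root_.IsClosed (K : Set E) := by
    have : (K : Set E) = Set.range S := by ext z; simp [K]
    rwa [this]
  have hKtop : K = ⊤ := by
    have : CompleteSpace K := hK.completeSpace_coe
    rw [← Submodule.orthogonal_eq_bot_iff, Submodule.eq_bot_iff]
    intro v hv
    refine hrange v fun u => ?_
    have hu : ((u : E), T u) ∈ T.closure.graph :=
      LinearPMap.le_graph_of_le T.le_closure (LinearPMap.mem_graph _ _)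
    exact Submodule.inner_right_of_mem_orthogonal
      (show T u - (c * Complex.I) • (u : E) ∈ K from ⟨⟨_, hu⟩, rfl⟩) hv
  obtain ⟨p, hp⟩ : z ∈ K := hKtop ▸ Submodule.mem_top
  exact ⟨p, p.2, hp⟩

/-- The basic criterion: a densely defined symmetric operator `T` such that `T ± i c` have dense
range is essentially self-adjoint. -/
theorem LinearPMap.IsFormalAdjoint.isEssentiallySelfAdjoint (hd : Dense (T.domain : Set E))
    (hsymm : T.IsFormalAdjoint T) {c : ℝ} (hc : 0 < c)
    (hminus : ∀ v, (∀ u : T.domain, ⟪T u - (c * Complex.I) • (u : E), v⟫_ℂ = 0) → v = 0)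
    (hplus : ∀ v, (∀ u : T.domain, ⟪T u + (c * Complex.I) • (u : E), v⟫_ℂ = 0) → v = 0) :
    IsEssentiallySelfAdjoint T := by
  have hle := hsymm.le_adjoint hd
  have hclos : T†.IsClosed := LinearPMap.adjoint_isClosed hd
  have hT : T.IsClosable := hclos.isClosable.leIsClosable hle
  refine ⟨hd, hsymm, hT, ?_⟩
  have hdC : Dense (T.closure.domain : Set E) := hd.mono T.le_closure.1
  have hgraph : T.closure.graph ≤ T†.graph := by
    rw [← hT.graph_closure_eq_closure_graph]
    exact Submodule.topologicalClosure_minimal _ (LinearPMap.le_graph_of_le hle) hclos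
  have hadj : T.closure† ≤ T† := by
    refine LinearPMap.IsFormalAdjoint.le_adjoint hd fun a u => ?_
    have h1 := LinearPMap.adjoint_isFormalAdjoint hdC u ⟨a, T.le_closure.1 a.2⟩
    have h2 : T.closure ⟨a, T.le_closure.1 a.2⟩ = T a := (T.le_closure.2 rfl).symm
    rw [h2] at h1
    rw [← inner_conj_symm, ← h1, inner_conj_symm]
  have hadj' : T† ≤ T.closure† := by
    refine LinearPMap.IsFormalAdjoint.le_adjoint hdC fun u a => ?_
    have h1 := LinearPMap.inner_eq_of_mem_graph_closure hT hd (LinearPMap.mem_graph _ u)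
      (LinearPMap.mem_graph _ a)
    rw [← inner_conj_symm, ← h1, inner_conj_symm]
  rw [LinearPMap.isSelfAdjoint_def]
  rw [le_antisymm hadj hadj']
  refine LinearPMap.eq_of_eq_graph (le_antisymm ?_ hgraph)
  rintro ⟨a, b⟩ hab
  -- The range of the closure shifted by −ic is everything, so (a, b) can be matched by a point of
  -- its graph; the difference lies in the kernel of T† − ic, which is orthogonal to the range of T
  -- + ic.
  obtain ⟨⟨x, y⟩, hxy, hz⟩ := LinearPMap.exists_mem_graph_sub_smul_eq hd hsymm hT hc hminus
    (b - (c * Complex.I) • a)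
  have hdiff : (a - x, b - y) ∈ T†.graph := T†.graph.sub_mem hab (hgraph hxy)
  have hby : b - y = (c * Complex.I) • (a - x) := by
    simp only at hz
    rw [smul_sub, sub_eq_sub_iff_sub_eq_sub, ← hz]
  have h0 : a - x = 0 := by
    refine hplus _ fun u => ?_
    have hu : ((u : E), T u) ∈ T.closure.graph :=
      LinearPMap.le_graph_of_le T.le_closure (LinearPMap.mem_graph _ _)
    have h1 := LinearPMap.inner_eq_of_mem_graph_closure hT hd hu hdiff
    rw [hby, inner_smul_left] at h1
    have h2 : ⟪T u + (c * Complex.I) • (u : E), a - x⟫_ℂ =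
        (starRingEnd ℂ) (⟪a - x, T u⟫_ℂ + (c * Complex.I) * ⟪a - x, (u : E)⟫_ℂ) := by
      rw [← inner_smul_right, ← inner_add_right, inner_conj_symm]
    have h3 : (starRingEnd ℂ) (c * Complex.I) = -(c * Complex.I) := by simp
    rw [h2, ← h1, h3, neg_mul, neg_add_cancel, _root_.map_zero]
  rw [h0, smul_zero] at hby
  rwa [sub_eq_zero.mp h0, sub_eq_zero.mp hby]

end Criterion

/-! ### Essential self-adjointness of L(t) -/

namespace PositiveSelfAdjoint

variable {E : Type*} [NormedAddCommGroup E] [InnerProductSpace ℂ E] [CompleteSpace E]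
  {H : PositiveSelfAdjoint E} {m N : ℕ}

namespace SymmetricWithCommutator

variable {ℓ : E →L[ℂ] E} {B : ℕ → E →L[ℂ] E}

/-- The commutator of L with A^j is skew-adjoint. This moves the bounded factor to the right of A^j,
as the quadratic form in the deficiency argument needs. -/
theorem star_sum_mul_inv_pow (h : SymmetricWithCommutator H m N ℓ B) {j : ℕ} (hj : j ≤ N + 1) :
    star (∑ l ∈ Finset.range j, B l) * H.inv ^ j = -(H.inv ^ j * ∑ l ∈ Finset.range j, B l) := by
  set D := ∑ l ∈ Finset.range j, B l with hD
  have hX := h.symm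
  have e1 : H.inv ^ m * (star D * H.inv ^ j) * H.inv ^ m =
      (H.inv ^ m * ℓ) * H.inv ^ j - H.inv ^ j * (H.inv ^ m * ℓ) := by
    have h1 := h.inv_pow_commutator hj
    rw [← star_sum, ← hD, ← neg_eq_iff_eq_neg, neg_sub] at h1
    rw [mul_assoc, mul_assoc (star D), ← pow_add, ← h1, mul_sub, ← mul_assoc, ← mul_assoc,
      ← mul_assoc, ← pow_add, ← pow_add, add_comm m j]
  have e2 := congrArg star e1
  simp only [star_sub, star_mul, star_star, hX.star_eq, (H.isSelfAdjoint_inv_pow m).star_eq,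
    (H.isSelfAdjoint_inv_pow j).star_eq] at e2
  refine H.inv_pow_mul_left_cancel m (H.inv_pow_mul_right_cancel m ?_)
  rw [e1, mul_neg, neg_mul, mul_assoc (H.inv ^ m) (H.inv ^ j * D), e2]
  abel

/-- The deficiency spaces of `L` vanish. -/
theorem eq_zero_of_inner_eq_zero (h : SymmetricWithCommutator H m N ℓ B) (hm : m ≤ N + 1) {c : ℝ}
    (hc : ‖∑ l ∈ Finset.range m, B l‖ < |c|) {v : E}
    (hv : ∀ x, ⟪ℓ x + (c * Complex.I) • (H.inv ^ m) x, v⟫_ℂ = 0) : v = 0 := by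
  set D := ∑ l ∈ Finset.range m, B l with hD
  have hsa := H.isSelfAdjoint_inv_pow m
  have e : ℓ * H.inv ^ m = H.inv ^ m * ℓ - H.inv ^ m * D * H.inv ^ m := by
    have h1 := h.inv_pow_commutator hm
    rw [← star_sum, ← hD, pow_add, ← mul_assoc, h.star_sum_mul_inv_pow hm, ← hD, neg_mul,
      neg_neg] at h1
    rw [← h1]; abel
  -- With x = A^m v and u = A^m v, the terms become a real number, −⟨Du, u⟩ and a purely imaginary
  -- multiple of c‖u‖²; the imaginary part contradicts ‖D‖ < |c| unless u = 0.
  have h1 := hv ((H.inv ^ m) v)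
  have e' : ℓ ((H.inv ^ m) v) =
      (H.inv ^ m * ℓ) v - (H.inv ^ m) (D ((H.inv ^ m) v)) := DFunLike.congr_fun e v
  rw [e', inner_add_left, inner_sub_left, inner_smul_left, hsa.inner_apply_left,
    hsa.inner_apply_left] at h1
  have hreal : (⟪(H.inv ^ m * ℓ) v, v⟫_ℂ).im = 0 := by
    rw [← Complex.conj_eq_iff_im, inner_conj_symm, h.symm.inner_apply_left]
  have him := congrArg Complex.im h1
  set u := (H.inv ^ m) v
  have hu : ⟪u, u⟫_ℂ = ((‖u‖ ^ 2 : ℝ) : ℂ) := by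
    rw [inner_self_eq_norm_sq_to_K]; norm_cast
  have h2 : |c| * ‖u‖ ^ 2 ≤ ‖D‖ * ‖u‖ ^ 2 := by
    have h3 : |(⟪D u, u⟫_ℂ).im| = |c| * ‖u‖ ^ 2 := by
      rw [hu] at him
      simp only [map_mul, Complex.conj_ofReal, Complex.conj_I, Complex.add_im, Complex.sub_im,
        hreal, zero_sub, Complex.mul_im, Complex.mul_re, Complex.ofReal_re, Complex.ofReal_im,
        Complex.neg_re, Complex.neg_im, Complex.I_re, Complex.I_im, Complex.zero_im] at him
      have h4 : (⟪D u, u⟫_ℂ).im = -(c * ‖u‖ ^ 2) := by linarith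
      rw [h4, abs_neg, abs_mul, abs_of_nonneg (sq_nonneg ‖u‖)]
    rw [← h3]
    calc _ ≤ ‖D u‖ * ‖u‖ := (Complex.abs_im_le_norm _).trans (norm_inner_le_norm _ _)
      _ ≤ ‖D‖ * ‖u‖ * ‖u‖ := by gcongr; exact D.le_opNorm u
      _ = _ := by ring
  have hu0 : u = 0 := by
    by_contra hne
    exact absurd (le_of_mul_le_mul_right h2 (by positivity)) (not_le.mpr hc)
  exact H.inv_pow_injective m (by rw [map_zero]; exact hu0)

theorem isEssentiallySelfAdjoint (h : SymmetricWithCommutator H m N ℓ B) (hm : m ≤ N + 1)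
    {T : E →ₗ.[ℂ] E} (hT : ∀ x, ∃ h : (H.inv ^ m) x ∈ T.domain, T ⟨_, h⟩ = ℓ x) {k : ℝ≥0}
    (hk : 2 * (m : ℝ≥0) ≤ k) :
    H.domainPow k ≤ T.domain ∧ IsEssentiallySelfAdjoint (T.domRestrict (H.domainPow k)) := by
  have hmk : (m : ℝ≥0) ≤ k / 2 := by
    rw [le_div_iff₀ two_pos, mul_comm]; exact hk
  have hpow : ∀ y, H.negPow (k / 2) y = (H.inv ^ m) (H.negPow (k / 2 - m) y) := fun y => by
    conv_lhs => rw [← add_tsub_cancel_of_le hmk, negPow_add, negPow_natCast]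
    rfl
  have hdom : H.domainPow k ≤ T.domain := by
    intro u hu
    obtain ⟨y, rfl⟩ := mem_domainPow_iff.mp hu
    rw [hpow]
    exact (hT _).1
  refine ⟨hdom, ?_⟩
  set R := T.domRestrict (H.domainPow k) with hR
  have hRu : ∀ u : R.domain, ∃ y, (u : E) = (H.inv ^ m) (H.negPow (k / 2 - m) y) ∧
      R u = ℓ (H.negPow (k / 2 - m) y) := by
    intro u
    obtain ⟨y, hy⟩ := mem_domainPow_iff.mp u.2.1
    obtain ⟨h1, h2⟩ := hT (H.negPow (k / 2 - m) y)
    rw [hpow] at hy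
    refine ⟨y, hy.symm, ?_⟩
    rw [← h2]
    exact LinearPMap.domRestrict_apply hy.symm
  have hRx : ∀ y, ∃ u : R.domain, (u : E) = (H.inv ^ m) (H.negPow (k / 2 - m) y) ∧
      R u = ℓ (H.negPow (k / 2 - m) y) := by
    intro y
    have hu : (H.inv ^ m) (H.negPow (k / 2 - m) y) ∈ H.domainPow k :=
      mem_domainPow_iff.mpr ⟨y, hpow y⟩
    obtain ⟨h1, h2⟩ := hT (H.negPow (k / 2 - m) y)
    refine ⟨⟨_, hu, h1⟩, rfl, ?_⟩
    rw [← h2]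
    exact LinearPMap.domRestrict_apply rfl
  have hd : Dense (R.domain : Set E) := by
    refine (H.denseRange_negPow (k / 2)).mono ?_
    rintro _ ⟨y, rfl⟩
    have : H.negPow (k / 2) y ∈ H.domainPow k := mem_domainPow_iff.mpr ⟨y, rfl⟩
    exact ⟨this, hdom this⟩
  have hsymm : R.IsFormalAdjoint R := by
    intro u v
    obtain ⟨x, hx, hx'⟩ := hRu u
    obtain ⟨y, hy, hy'⟩ := hRu v
    have hsa := H.isSelfAdjoint_inv_pow m
    rw [hx', hy', hx, hy, ← hsa.inner_apply_left, hsa.inner_apply_left (H.negPow _ x)]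
    exact h.symm.inner_apply_left _ _
  have hv : ∀ c : ℝ, ‖∑ l ∈ Finset.range m, B l‖ < |c| → ∀ v,
      (∀ u : R.domain, ⟪R u + (c * Complex.I) • (u : E), v⟫_ℂ = 0) → v = 0 := by
    intro c hc v hv
    refine h.eq_zero_of_inner_eq_zero hm hc fun x => ?_
    -- H^k corresponds to x in the dense range of A^{k/2−m}; continuity of ℓ extends the
    -- orthogonality to all x, so the choice of k ≥ 2m is immaterial.
    refine congrFun ((H.denseRange_negPow (k / 2 - m)).equalizer
      (g := fun x => ⟪ℓ x + (c * Complex.I) • (H.inv ^ m) x, v⟫_ℂ) (h := fun _ => 0)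
      (by fun_prop) (by fun_prop) (funext fun y => ?_)) x
    obtain ⟨u, hu, hu'⟩ := hRx y
    have := hv u
    rwa [hu, hu'] at this
  set c := ‖∑ l ∈ Finset.range m, B l‖ + 1
  have hc : 0 < c := by positivity
  have hc1 : ‖∑ l ∈ Finset.range m, B l‖ < |c| := by rw [abs_of_pos hc]; exact lt_add_one _
  refine hsymm.isEssentiallySelfAdjoint hd hc (fun v hv' => hv (-c) (by rwa [abs_neg]) v fun u => ?_)
    (hv c hc1)
  have := hv' u
  simpa [sub_eq_add_neg] using this

end SymmetricWithCommutator

end PositiveSelfAdjoint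

end

/-! ### The main theorem -/

theorem theorem1p1 {E : Type*} [NormedAddCommGroup E] [InnerProductSpace ℂ E] [CompleteSpace E]
    (H : PositiveSelfAdjoint E) (L : ℝ → E →ₗ.[ℂ] E) (m k₀ : ℕ) (k₁ : ℝ≥0)
    (hk₀ : 2 * m < k₀) (hk₁ : 2 * (m : ℝ≥0) < k₁)
    (h0 : H.BoundedContinuousFamily L m k₀)
    (h1 : ∀ t, H.SymmetricOn (L t) (k₀ + 2 * m))
    (h2 : H.BoundedContinuousCommutator L k₁) :
    (∃ W : ℝ → ℝ → E ≃ₗᵢ[ℂ] E,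
      (∀ t r s x, W t s x = W t r (W r s x)) ∧ (∀ s x, W s s x = x) ∧
      ∀ k : ℝ≥0, k + 4 * m ≤ min (k₀ : ℝ≥0) k₁ →
        ∃ U : ℝ → ℝ → H.Scale k →L[ℂ] H.Scale k,
          H.IsPropagator L m k U ∧
          (∀ V, H.IsPropagator L m k V → V = U) ∧
          (∀ t s (w : H.Scale k), ‖(U t s w : E)‖ = ‖(w : E)‖) ∧
          ((∀ t r s, U t s = (U t r).comp (U r s)) ∧
            ∀ s, U s s = ContinuousLinearMap.id ℂ (H.Scale k)) ∧
          (∃ C : ℝ, 0 < C ∧ ∀ t s, ‖U t s‖ ≤ C * Real.exp (C * |t - s|)) ∧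
          ∀ t s (w : H.Scale k), W t s (w : E) = (U t s w : E)) ∧
    ∀ (t : ℝ) (k : ℝ≥0), 2 * (m : ℝ≥0) ≤ k →
      H.domainPow k ≤ (L t).domain ∧
        IsEssentiallySelfAdjoint ((L t).domRestrict (H.domainPow k)) := by
  obtain ⟨ℓ, B, hfam, hℓ⟩ := PositiveSelfAdjoint.exists_commutatorFamily hk₁ h0 h1 h2
  refine ⟨?_, fun t k hk =>
    (hfam.symm t).isEssentiallySelfAdjoint (hfam.le.trans (Nat.le_succ _)) (hℓ t) hk⟩
  obtain ⟨U, hU, hc, hbd, hweak⟩ := hfam.exists_unitaryEvolution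
  -- W is built from U before k is chosen, and each propagator is a restriction of U; hence the
  -- extension is the same for all k.
  let W : ℝ → ℝ → E ≃ₗᵢ[ℂ] E := fun t s =>
    { toLinearMap := (U t s).toLinearMap
      invFun := U s t
      left_inv := fun x => by
        change U s t (U t s x) = x
        rw [hU.apply_apply, hU.refl_apply]
      right_inv := fun x => by
        change U t s (U s t x) = x
        rw [hU.apply_apply, hU.refl_apply]
      norm_map' := fun x => hU.norm_apply t s x }
  have hW : ∀ t s x, W t s x = U t s x := fun _ _ _ => rfl
  refine ⟨W, fun t r s x => ?_, fun s x => ?_, fun k hk => ?_⟩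
  · rw [hW, hW, hW, hU.apply_apply]
  · rw [hW, hU.refl_apply]
  · have hkk₀ : k ≤ k₀ := le_self_add.trans (hk.trans (min_le_left _ _))
    -- The commutator bounds are needed only up to k/2 + m, which is at most k + 4m ≤ k₁.
    have hkN : ⌊k / 2 + m⌋₊ ≤ ⌊k₁⌋₊ := by
      refine Nat.floor_le_floor (le_trans ?_ (hk.trans (min_le_right _ _)))
      gcongr
      · exact div_le_self zero_le one_le_two
      · exact le_mul_of_one_le_left zero_le (by norm_num)
    obtain ⟨V, hV, hVU, C, hC0, hVn⟩ :=
      PositiveSelfAdjoint.exists_isPropagator h0 hfam hℓ hU hc hbd hweak hkk₀ hkN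
    refine ⟨V, hV, fun V' hV' => hV.unique hV', fun t s w => ?_, ⟨fun t r s => ?_, fun s => ?_⟩,
      ⟨C + 1, by positivity, fun t s => ?_⟩, fun t s w => ?_⟩
    · rw [hVU, hU.norm_apply]
    · ext w
      refine PositiveSelfAdjoint.Scale.coe_injective ?_
      rw [ContinuousLinearMap.comp_apply, hVU, hVU, hVU, hU.apply_apply]
    · ext w
      refine PositiveSelfAdjoint.Scale.coe_injective ?_
      rw [hVU, hU.refl_apply]
      rfl
    · calc ‖V t s‖ ≤ 1 * Real.exp (C * |t - s|) := by rw [one_mul]; exact hVn t s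
        _ ≤ (C + 1) * Real.exp ((C + 1) * |t - s|) := by gcongr <;> linarith
    · rw [hW, hVU]
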